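/- Let $m_1,m_2,n\ge 1$, $d=m_1+m_2$, $\gamma>0$, and let $\Pi$ be a probability distribution on $[m_1]\times[m_2]$ such that, for some $\mu\ge 1$, $\pi_{k,l}:=\Pi(\{(k,l)\})\ge 1/(\mu m_1m_2)$ for all $(k,l)$. Let $f:\mathbb R\to[0,1]$ be differentiable at every point of $[-\gamma,\gamma]$ with $0<f<1$ there, and put $$M_\gamma=\sup_{|x|\le\gamma}2|\log f(x)|,\qquad L_\gamma=\max\Big(\sup_{|x|\le\gamma}\frac{|f'(x)|}{f(x)},\ \sup_{|x|\le\gamma}\frac{|f'(x)|}{1-f(x)}\Big),\qquad K_\gamma=\inf_{|x|\le\gamma}\frac{f'(x)^2}{8f(x)(1-f(x))},$$ where $K_\gamma>0$ is assumed. Let $\bar X\in\mathbb R^{m_1\times m_2}$ with $\|\bar X\|_\infty=\max_{k,l}|\bar X_{k,l}|\le\gamma$. Let $(\omega_i,Y_i)_{1\le i\le n}$ be independent pairs, where $\omega_i$ has law $\Pi$ and, given $\omega_i$, $Y_i\in\{1,2\}$ equals $1$ with probability $f(\bar X_{\omega_i})$ and $2$ with probability $1-f(\bar X_{\omega_i})$.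 Let $$\Phi(X)=-\frac1n\sum_{i=1}^n\big[\mathbf 1_{\{Y_i=1\}}\log f(X_{\omega_i})+\mathbf 1_{\{Y_i=2\}}\log(1-f(X_{\omega_i}))\big],$$ and assume that $\Phi$ is convex on $\{X:\|X\|_\infty\le\gamma\}$ for all values of the observations. For $\lambda>0$ let $\hat X$ denote any minimizer of $\Phi(X)+\lambda\|X\|_{\sigma,1}$ over $\{X:\|X\|_\infty\le\gamma\}$, where $\|\cdot\|_{\sigma,1}$ is the nuclear norm (the sum of the singular values). Let $\|\cdot\|_{\mathrm{op}}$ be the operator norm (the largest singular value), and let $\Sigma_R=\frac1n\sum_{i=1}^n\varepsilon_iE_i$, where $E_i$ is the $m_1\times m_2$ matrix with a single non-zero entry, equal to $1$, at position $\omega_i$, and $(\varepsilon_i)$ is a Rademacher sequence independent of $(\omega_i,Y_i)_{i}$. For matrices $P,Q$ with entries in $(0,1)$ let $$\mathrm{KL}(P,Q)=\frac1{m_1m_2}\sum_{k,l}\Big[P_{k,l}\log\frac{P_{k,l}}{Q_{k,l}}+(1-P_{k,l})\log\frac{1-P_{k,l}}{1-Q_{k,l}}\Big],$$ and let $f(X)$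 be the matrix obtained by applying $f$ to each entry of $X$. Then there is a universal constant $c^*>0$ (independent of all the objects above) such that, with probability at least $1-2/d$, the following holds: for every $\lambda>0$ with $\lambda\ge 2\|\nabla\Phi(\bar X)\|_{\mathrm{op}}$ and every such $\hat X$, $$\mathrm{KL}(f(\bar X),f(\hat X))\le 8\max\Big(\frac{\mu^2}{K_\gamma}\,m_1m_2\,\mathrm{rank}(\bar X)\big(\lambda^2+c^*L_\gamma^2(\mathbb E\|\Sigma_R\|_{\mathrm{op}})^2\big),\ \mu e M_\gamma\frac{\sqrt{\log d}}{n}\Big).$$ -/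

import Mathlib

open MeasureTheory ProbabilityTheory

namespace MatrixCompletion

noncomputable section

/-- Operator norm of a real matrix, as a map between Euclidean spaces (its largest singular
value). -/
def opNorm {m₁ m₂ : ℕ} (A : Matrix (Fin m₁) (Fin m₂) ℝ) : ℝ :=
  ‖LinearMap.toContinuousLinearMap (Matrix.toEuclideanLin A)‖

/-- Nuclear norm (Schatten 1-norm): the sum of the singular values. -/
def nuclearNorm {m₁ m₂ : ℕ} (A : Matrix (Fin m₁) (Fin m₂) ℝ) : ℝ :=
  ∑ i ∈ Finset.range (min m₁ m₂), (Matrix.toEuclideanLin A).singularValues i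

/-- The matrices `X` with `‖X‖_∞ = max |X k l| ≤ γ`. -/
def box (m₁ m₂ : ℕ) (γ : ℝ) : Set (Matrix (Fin m₁) (Fin m₂) ℝ) :=
  {X | ∀ k l, |X k l| ≤ γ}

/-- Kullback-Leibler divergence between two matrices of success probabilities (two classes). -/
def klDiv {m₁ m₂ : ℕ} (X X' : Matrix (Fin m₁) (Fin m₂) ℝ) : ℝ :=
  1 / ((m₁ : ℝ) * m₂) * ∑ k, ∑ l,
    (X k l * Real.log (X k l / X' k l) +
      (1 - X k l) * Real.log ((1 - X k l) / (1 - X' k l)))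

/-- `M_γ = sup_{|x| ≤ γ} 2 |log f(x)|`. -/
def constM (f : ℝ → ℝ) (γ : ℝ) : ℝ :=
  ⨆ x : Set.Icc (-γ) γ, 2 * |Real.log (f x)|

/-- `L_γ = max (sup_{|x| ≤ γ} |f'(x)| / f(x), sup_{|x| ≤ γ} |f'(x)| / (1 - f(x)))`. -/
def constL (f : ℝ → ℝ) (γ : ℝ) : ℝ :=
  max (⨆ x : Set.Icc (-γ) γ, |deriv f x| / f x)
    (⨆ x : Set.Icc (-γ) γ, |deriv f x| / (1 - f x))

/-- `K_γ = inf_{|x| ≤ γ} f'(x)² / (8 f(x) (1 - f(x)))`. -/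
def constK (f : ℝ → ℝ) (γ : ℝ) : ℝ :=
  ⨅ x : Set.Icc (-γ) γ, deriv f x ^ 2 / (8 * f x * (1 - f x))

/-- Normalized negative log-likelihood of the observed positions `w` and labels `y`; the label
`true` is the first class (of probability `f`), `false` the second one (of probability `1 - f`). -/
def negLogLik {m₁ m₂ n : ℕ} (f : ℝ → ℝ) (w : Fin n → Fin m₁ × Fin m₂) (y : Fin n → Bool)
    (X : Matrix (Fin m₁) (Fin m₂) ℝ) : ℝ :=
  -(1 / (n : ℝ)) * ∑ i,
    (if y i = true then Real.log (f (X (w i).1 (w i).2))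
      else Real.log (1 - f (X (w i).1 (w i).2)))

/-- Gradient of a function of a matrix: the matrix of its partial derivatives. -/
def gradMat {m₁ m₂ : ℕ} (Φ : Matrix (Fin m₁) (Fin m₂) ℝ → ℝ)
    (X : Matrix (Fin m₁) (Fin m₂) ℝ) : Matrix (Fin m₁) (Fin m₂) ℝ :=
  Matrix.of fun k l => deriv (fun t : ℝ => Φ (X + Matrix.single k l t)) 0

/-- `Xhat` is a nuclear-norm penalized maximum likelihood estimator: it minimizes
`negLogLik + lam * nuclearNorm` over the matrices with entries bounded by `γ`. -/
def IsPenalizedMLE {m₁ m₂ n : ℕ} (f : ℝ → ℝ) (γ lam : ℝ) (w : Fin n → Fin m₁ × Fin m₂)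
    (y : Fin n → Bool) (Xhat : Matrix (Fin m₁) (Fin m₂) ℝ) : Prop :=
  Xhat ∈ box m₁ m₂ γ ∧
    IsMinOn (fun X => negLogLik f w y X + lam * nuclearNorm X) (box m₁ m₂ γ) Xhat

/-- The binary observation model: the pairs `(W i, Y i)` are independent, the position `W i` has
law `Pi`, and given `W i = (k, l)` the label `Y i` is `true` with probability `f (Xbar k l)` and
`false` with probability `1 - f (Xbar k l)`. -/
structure IsBinarySample {m₁ m₂ n : ℕ} {Ω : Type*} [MeasurableSpace Ω] (P : Measure Ω)
    (Pi : Measure (Fin m₁ × Fin m₂)) (f : ℝ → ℝ) (Xbar : Matrix (Fin m₁) (Fin m₂) ℝ)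
    (W : Fin n → Ω → Fin m₁ × Fin m₂) (Y : Fin n → Ω → Bool) : Prop where
  measurable_W : ∀ i, Measurable (W i)
  measurable_Y : ∀ i, Measurable (Y i)
  indep : iIndepFun (fun i ω => (W i ω, Y i ω)) P
  law_true : ∀ i k l,
    P.real {ω | W i ω = (k, l) ∧ Y i ω = true} = Pi.real {(k, l)} * f (Xbar k l)
  law_false : ∀ i k l,
    P.real {ω | W i ω = (k, l) ∧ Y i ω = false} = Pi.real {(k, l)} * (1 - f (Xbar k l))

/-- Independent random signs. -/
structure IsRademacherSequence {n : ℕ} {Ω : Type*} [MeasurableSpace Ω] (P : Measure Ω)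
    (ε : Fin n → Ω → ℝ) : Prop where
  measurable : ∀ i, Measurable (ε i)
  indep : iIndepFun ε P
  prob_one : ∀ i, P.real {ω | ε i ω = 1} = 1 / 2
  prob_neg_one : ∀ i, P.real {ω | ε i ω = -1} = 1 / 2

/-- `Σ_R = (1/n) ∑ i, ε i • E i`, where `E i` is the matrix unit at position `w i`. -/
def sigmaR {m₁ m₂ n : ℕ} (w : Fin n → Fin m₁ × Fin m₂) (ε : Fin n → ℝ) :
    Matrix (Fin m₁) (Fin m₂) ℝ :=
  (1 / (n : ℝ)) • ∑ i, ε i • Matrix.single (w i).1 (w i).2 (1 : ℝ)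

end

end MatrixCompletion

namespace MatrixCompletion

/-! The proof combines a cone condition for the nuclear norm with a localized uniform deviation
bound, and gets its concentration from a variance estimate.

Write `breg` for the Bregman divergence of the one-label loss at the true entry. The score has mean
zero, so the mean of `breg` under one observation is the Kullback-Leibler divergence (`mean_breg`),
and its average over entries, weighted by `Pi`, is `popRisk`. Optimality of the estimator, the
condition on `lam` and decomposability of the nuclear norm (`exists_decomposition`) bound both the
nuclear norm of the error and the empirical mean of `breg` by multiples of √rank times the Frobenius
norm of the error (`IsPenalizedMLE.basic_inequality`). Since KL dominates squared Hellinger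
distance, it dominates `constK` times the squared difference of parameters (`klTerm_link_ge`). With
ρ = rank · μ m₁ m₂ / K and D the population risk of the estimator, rank · ‖error‖_F² ≤ ρ D. Hence,
if the empirical mean of `breg` is at least 3D/4, then D ≤ 8 ρ lam².

It remains to exclude a large gap between population and empirical means. At scale T, consider the X
with D ≤ T and squared nuclear norm of X - Xbar at most 32 ρ T. Symmetrization, contraction and
operator/nuclear duality bound the mean of the supremum by a multiple of L √(ρT) E‖Σ_R‖. The
summands lie in [0, M] with M = 4γL and have mean at most T, so Efron-Stein bounds the variance of
the unnormalized supremum by n M T, and Chebyshev gives failure probability of order M / (nT)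
(`IsBinarySample.deviation_le`). Peeling over T = 2^(l+1) T₀, with T₀ a multiple of ρ L² (E‖Σ_R‖)²,
makes these probabilities summable.

The sum is at most 2/d because T₀ cannot be small: a Khinchin-type bound gives min(m₁, m₂) (E‖Σ_R‖)²
≥ 1/(3n) (`prodExp_opNorm_signedCount_ge`), and M ≤ L²/K (`four_mul_constL_le`). The first term of
the maximum therefore suffices when rank > 0; the second enters only through its nonnegativity, when
rank = 0. -/

/-- Expectation of `F` under the `n`-fold product of the weights `p` on a finite type. -/
noncomputable def prodExp {S : Type*} [Fintype S] (p : S → ℝ) (n : ℕ) (F : (Fin n → S) → ℝ) : ℝ :=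
  ∑ z, (∏ i, p (z i)) * F z

/-! ### Finite product expectations, Efron-Stein and Chebyshev inequalities. -/

section ProdExp

variable {S : Type*} [Fintype S] {p : S → ℝ} {n : ℕ}

theorem prodExp_zero (F : (Fin 0 → S) → ℝ) : prodExp p 0 F = F Fin.elim0 := by
  simp only [prodExp, Finset.univ_eq_empty, Finset.prod_empty, one_mul]
  rw [Fintype.sum_unique]
  congr 1

theorem prodExp_add (F G : (Fin n → S) → ℝ) :
    prodExp p n (fun z => F z + G z) = prodExp p n F + prodExp p n G := by
  simp only [prodExp, mul_add, Finset.sum_add_distrib]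

theorem prodExp_const_mul (c : ℝ) (F : (Fin n → S) → ℝ) :
    prodExp p n (fun z => c * F z) = c * prodExp p n F := by
  simp only [prodExp, Finset.mul_sum]
  exact Finset.sum_congr rfl fun z _ => by ring

theorem prodExp_sub (F G : (Fin n → S) → ℝ) :
    prodExp p n (fun z => F z - G z) = prodExp p n F - prodExp p n G := by
  simp only [prodExp, mul_sub, Finset.sum_sub_distrib]

theorem prodExp_sum {J : Type*} (s : Finset J) (F : J → (Fin n → S) → ℝ) :
    prodExp p n (fun z => ∑ j ∈ s, F j z) = ∑ j ∈ s, prodExp p n (F j) := by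
  simp only [prodExp, Finset.mul_sum]
  exact Finset.sum_comm

theorem prodExp_mono (hp : ∀ s, 0 ≤ p s) {F G : (Fin n → S) → ℝ} (h : ∀ z, F z ≤ G z) :
    prodExp p n F ≤ prodExp p n G :=
  Finset.sum_le_sum fun z _ =>
    mul_le_mul_of_nonneg_left (h z) (Finset.prod_nonneg fun i _ => hp (z i))

theorem prodExp_succ (F : (Fin (n + 1) → S) → ℝ) :
    prodExp p (n + 1) F = ∑ s, p s * prodExp p n (fun z => F (Fin.cons s z)) := by
  simp only [prodExp]
  rw [← (Fin.consEquiv fun _ => S).sum_comp, Fintype.sum_prod_type]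
  refine Finset.sum_congr rfl fun s _ => ?_
  rw [Finset.mul_sum]
  refine Finset.sum_congr rfl fun z _ => ?_
  simp [Fin.consEquiv, Fin.prod_univ_succ, mul_assoc]

theorem prodExp_succ_inner (F : (Fin (n + 1) → S) → ℝ) :
    prodExp p (n + 1) F = prodExp p n (fun z => ∑ s, p s * F (Fin.cons s z)) := by
  rw [prodExp_succ, prodExp_sum]
  exact Finset.sum_congr rfl fun s _ => (prodExp_const_mul _ _).symm

theorem prodExp_const (hp1 : ∑ s, p s = 1) (c : ℝ) : prodExp p n (fun _ => c) = c := by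
  induction n with
  | zero => rw [prodExp_zero]
  | succ n ih => rw [prodExp_succ]; simp only [ih, ← Finset.sum_mul, hp1, one_mul]

theorem sq_prodExp_le (hp : ∀ s, 0 ≤ p s) (hp1 : ∑ s, p s = 1) (F : (Fin n → S) → ℝ) :
    prodExp p n F ^ 2 ≤ prodExp p n (fun z => F z ^ 2) := by
  have h : prodExp p n (fun z => F z ^ 2) - prodExp p n F ^ 2
      = prodExp p n (fun z => (F z - prodExp p n F) ^ 2) := by
    have : (fun z => (F z - prodExp p n F) ^ 2)
        = fun z => F z ^ 2 - (2 * prodExp p n F) * F z + prodExp p n F ^ 2 := by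
      funext z; ring
    rw [this, prodExp_add, prodExp_sub, prodExp_const_mul, prodExp_const hp1]
    ring
  have h0 : prodExp p n (fun _ => 0) ≤ prodExp p n (fun z => (F z - prodExp p n F) ^ 2) :=
    prodExp_mono hp fun z => sq_nonneg _
  rw [prodExp_const hp1] at h0
  linarith

/-- Jensen's inequality for the convex function x ↦ max(x, 0)². In `efron_stein` it replaces a
difference of conditional means by a difference of values of `F`. -/
theorem posPart_sq_prodExp_le (hp : ∀ s, 0 ≤ p s) (hp1 : ∑ s, p s = 1) (F : (Fin n → S) → ℝ) :
    max (prodExp p n F) 0 ^ 2 ≤ prodExp p n (fun z => max (F z) 0 ^ 2) := by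
  refine le_trans ?_ (sq_prodExp_le hp hp1 _)
  refine pow_le_pow_left₀ (le_max_right _ _) (max_le ?_ ?_) 2
  · exact prodExp_mono hp fun z => le_max_left _ _
  · exact (prodExp_const (p := p) (n := n) hp1 0).symm.le.trans
      (prodExp_mono hp fun z => le_max_right _ _)

/-- The variance is half the mean square of the difference of two independent copies; by
exchangeability the positive and negative parts contribute equally, which absorbs the factor 1/2. -/
theorem sum_mul_sq_sub_eq (hp1 : ∑ s, p s = 1) (G : S → ℝ) :
    ∑ s, p s * (G s - ∑ s', p s' * G s') ^ 2
      = ∑ s, p s * ∑ s', p s' * max (G s - G s') 0 ^ 2 := by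
  set m := ∑ s', p s' * G s' with hm
  have h1 : ∑ s, p s * (G s - m) ^ 2 = ∑ s, p s * G s ^ 2 - m ^ 2 := by
    have : ∀ s, p s * (G s - m) ^ 2 = p s * G s ^ 2 - 2 * m * (p s * G s) + m ^ 2 * p s := by
      intro s; ring
    simp only [this, Finset.sum_add_distrib, Finset.sum_sub_distrib, ← Finset.mul_sum, hp1, ← hm]
    ring
  have h2 : ∑ s, p s * ∑ s', p s' * (G s - G s') ^ 2 = 2 * (∑ s, p s * G s ^ 2 - m ^ 2) := by
    have : ∀ s, ∑ s', p s' * (G s - G s') ^ 2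
        = G s ^ 2 - 2 * G s * m + ∑ s', p s' * G s' ^ 2 := by
      intro s
      have : ∀ s', p s' * (G s - G s') ^ 2
          = G s ^ 2 * p s' - 2 * G s * (p s' * G s') + p s' * G s' ^ 2 := by intro s'; ring
      simp only [this, Finset.sum_add_distrib, Finset.sum_sub_distrib, ← Finset.mul_sum, hp1, ← hm]
      ring
    simp only [this]
    have h3 : ∀ s, p s * (G s ^ 2 - 2 * G s * m + ∑ s', p s' * G s' ^ 2)
        = p s * G s ^ 2 - 2 * m * (p s * G s) + (∑ s', p s' * G s' ^ 2) * p s := by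
      intro s; ring
    simp only [h3, Finset.sum_add_distrib, Finset.sum_sub_distrib, ← Finset.mul_sum, hp1, ← hm]
    ring
  have h3 : ∑ s, p s * ∑ s', p s' * (G s - G s') ^ 2
      = 2 * ∑ s, p s * ∑ s', p s' * max (G s - G s') 0 ^ 2 := by
    have h4 : ∑ s, p s * ∑ s', p s' * max (G s - G s') 0 ^ 2
        = ∑ s, p s * ∑ s', p s' * max (G s' - G s) 0 ^ 2 := by
      simp only [Finset.mul_sum]
      rw [Finset.sum_comm]
      exact Finset.sum_congr rfl fun s _ => Finset.sum_congr rfl fun s' _ => by ring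
    have h5 : ∀ x : ℝ, x ^ 2 = max x 0 ^ 2 + max (-x) 0 ^ 2 := by
      intro x
      rcases le_total 0 x with h | h
      · rw [max_eq_left h, max_eq_right (by linarith)]; ring
      · rw [max_eq_right h, max_eq_left (by linarith)]; ring
    have h6 : ∀ s s', p s' * (G s - G s') ^ 2
        = p s' * max (G s - G s') 0 ^ 2 + p s' * max (G s' - G s) 0 ^ 2 := by
      intro s s'
      rw [h5 (G s - G s'), neg_sub]; ring
    simp only [h6, Finset.sum_add_distrib, mul_add]
    linarith
  linarith

/-- One-sided Efron-Stein inequality. -/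
theorem efron_stein (hp : ∀ s, 0 ≤ p s) (hp1 : ∑ s, p s = 1) (F : (Fin n → S) → ℝ) :
    prodExp p n (fun z => (F z - prodExp p n F) ^ 2) ≤
      prodExp p n (fun z => ∑ i, ∑ s, p s * max (F z - F (Function.update z i s)) 0 ^ 2) := by
  induction n with
  | zero => simp [prodExp_zero]
  | succ n ih =>
    set G : S → ℝ := fun s => prodExp p n (fun z => F (Fin.cons s z)) with hG
    have hm : prodExp p (n + 1) F = ∑ s, p s * G s := prodExp_succ F
    -- Law of total variance with respect to the first coordinate: the conditional variance goes to
    -- the induction hypothesis, the variance of the conditional mean `G` to the one-coordinate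
    -- identity.
    have hL : prodExp p (n + 1) (fun z => (F z - prodExp p (n + 1) F) ^ 2)
        = ∑ s, p s * prodExp p n (fun z => (F (Fin.cons s z) - G s) ^ 2)
          + ∑ s, p s * (G s - ∑ s', p s' * G s') ^ 2 := by
      rw [prodExp_succ, ← Finset.sum_add_distrib, ← hm]
      refine Finset.sum_congr rfl fun s _ => ?_
      set m := prodExp p (n + 1) F
      have : (fun z : Fin n → S => (F (Fin.cons s z) - m) ^ 2)
          = fun z : Fin n → S => ((F (Fin.cons s z) - G s) ^ 2
            + (2 * (G s - m)) * (F (Fin.cons s z) - G s)) + (G s - m) ^ 2 := by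
        funext z; ring
      rw [this, prodExp_add, prodExp_add, prodExp_const_mul, prodExp_sub, prodExp_const hp1,
        prodExp_const hp1]
      simp only [hG]
      ring
    rw [hL, prodExp_succ, sum_mul_sq_sub_eq hp1, ← Finset.sum_add_distrib]
    refine Finset.sum_le_sum fun s _ => ?_
    rw [← mul_add]
    refine mul_le_mul_of_nonneg_left ?_ (hp s)
    simp only [Fin.sum_univ_succ, Fin.update_cons_zero, ← Fin.cons_update]
    rw [prodExp_add, add_comm]
    refine add_le_add ?_ (ih fun z => F (Fin.cons s z))
    rw [prodExp_sum]
    refine Finset.sum_le_sum fun s' _ => ?_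
    rw [prodExp_const_mul]
    refine mul_le_mul_of_nonneg_left ?_ (hp s')
    have h := posPart_sq_prodExp_le hp hp1
      (fun z : Fin n → S => F (Fin.cons s z) - F (Fin.cons s' z))
    rw [prodExp_sub] at h
    exact h

theorem chebyshev_prodExp (hp : ∀ s, 0 ≤ p s) {F : (Fin n → S) → ℝ} {m V t : ℝ} (ht : 0 < t)
    (hm : prodExp p n F ≤ m) (hV : prodExp p n (fun z => (F z - prodExp p n F) ^ 2) ≤ V)
    (A : Set (Fin n → S)) (hA : ∀ z ∈ A, m + t ≤ F z) :
    prodExp p n (A.indicator 1) ≤ V / t ^ 2 := by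
  rw [le_div_iff₀ (by positivity), mul_comm, ← prodExp_const_mul]
  refine le_trans (prodExp_mono hp fun z => ?_) hV
  by_cases hz : z ∈ A
  · rw [Set.indicator_of_mem hz, Pi.one_apply, mul_one]
    exact pow_le_pow_left₀ ht.le (by linarith [hA z hz]) 2
  · rw [Set.indicator_of_notMem hz, mul_zero]
    positivity

end ProdExp

/-! ### Symmetrization, contraction and variance of suprema. -/

section Symmetrization

variable {S I : Type*} [Fintype S] {p : S → ℝ} [Fintype I] [Nonempty I]

/-- The maximum of a function on a finite nonempty type. -/
noncomputable def maxOf (a : I → ℝ) : ℝ := Finset.univ.sup' Finset.univ_nonempty a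

theorem le_maxOf (a : I → ℝ) (i : I) : a i ≤ maxOf a := Finset.le_sup' a (Finset.mem_univ i)

theorem exists_maxOf (a : I → ℝ) : ∃ i, maxOf a = a i := by
  obtain ⟨i, -, hi⟩ := Finset.exists_mem_eq_sup' Finset.univ_nonempty a
  exact ⟨i, hi⟩

/-- One-coordinate contraction principle. -/
theorem maxOf_contraction {L : ℝ} {g t : I → ℝ} (h : ∀ i j, |g i - g j| ≤ L * |t i - t j|)
    (a : I → ℝ) :
    maxOf (fun i => a i + g i) + maxOf (fun i => a i - g i)
      ≤ maxOf (fun i => a i + L * t i) + maxOf (fun i => a i - L * t i) := by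
  obtain ⟨i, hi⟩ := exists_maxOf (fun i => a i + g i)
  obtain ⟨j, hj⟩ := exists_maxOf (fun i => a i - g i)
  rw [hi, hj]
  -- The two maximizers are tested on the right-hand side, `i` with the plus sign if `t i ≥ t j` and
  -- with the minus sign otherwise.
  have h1 := (le_abs_self _).trans (h i j)
  rcases le_total (t j) (t i) with ht | ht
  · rw [abs_of_nonneg (by linarith)] at h1
    have h2 := le_maxOf (fun i => a i + L * t i) i
    have h3 := le_maxOf (fun i => a i - L * t i) j
    linarith
  · rw [abs_of_nonpos (by linarith)] at h1
    have h2 := le_maxOf (fun i => a i + L * t i) j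
    have h3 := le_maxOf (fun i => a i - L * t i) i
    linarith

/-- The value `±1` attached to a bit. -/
def sgn (b : Bool) : ℝ := if b = true then 1 else -1

/-- One-coordinate symmetrization and contraction. -/
theorem sum_maxOf_le (hp : ∀ s, 0 ≤ p s) (hp1 : ∑ s, p s = 1) {L : ℝ} {g t : I → S → ℝ}
    (h : ∀ i j s, |g i s - g j s| ≤ L * |t i s - t j s|) (a : I → ℝ) :
    ∑ s, p s * maxOf (fun i => a i + (∑ s', p s' * g i s' - g i s))
      ≤ ∑ v : S × Bool, p v.1 / 2 * maxOf (fun i => a i + 2 * L * (sgn v.2 * t i v.1)) := by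
  set U : S → ℝ := fun s => maxOf fun i => a i + 2 * g i s with hU
  set V : S → ℝ := fun s => maxOf fun i => a i - 2 * g i s
  -- Here a + E g - g(s) is the midpoint of a + 2 E g and a - 2 g(s). Maxima are subadditive, and
  -- the mean moves outside the first one. The two halves become the two values of a random sign, so
  -- one coordinate can be treated at a time.
  have h1 : ∀ s, maxOf (fun i => a i + (∑ s', p s' * g i s' - g i s))
      ≤ (∑ s', p s' * U s') / 2 + V s / 2 := by
    intro s
    obtain ⟨i, hi⟩ := exists_maxOf (fun i => a i + (∑ s', p s' * g i s' - g i s))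
    rw [hi]
    have hV' : a i - 2 * g i s ≤ V s := le_maxOf (fun i => a i - 2 * g i s) i
    have hU' : ∑ s', p s' * (a i + 2 * g i s') ≤ ∑ s', p s' * U s' :=
      Finset.sum_le_sum fun s' _ =>
        mul_le_mul_of_nonneg_left (le_maxOf (fun i => a i + 2 * g i s') i) (hp s')
    have h2 : ∑ s', p s' * (a i + 2 * g i s') = a i + 2 * ∑ s', p s' * g i s' := by
      simp only [mul_add, Finset.sum_add_distrib, ← Finset.sum_mul, hp1, one_mul, Finset.mul_sum]
      congr 1
      exact Finset.sum_congr rfl fun _ _ => by ring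
    linarith
  calc ∑ s, p s * maxOf (fun i => a i + (∑ s', p s' * g i s' - g i s))
      ≤ ∑ s, p s * ((∑ s', p s' * U s') / 2 + V s / 2) :=
        Finset.sum_le_sum fun s _ => mul_le_mul_of_nonneg_left (h1 s) (hp s)
    _ = ∑ s, p s / 2 * (U s + V s) := by
        simp only [mul_add, Finset.sum_add_distrib, ← Finset.sum_mul, hp1, one_mul]
        rw [Finset.sum_div]
        congr 1 <;> exact Finset.sum_congr rfl fun _ _ => by ring
    _ ≤ ∑ s, p s / 2 * (maxOf (fun i => a i + 2 * L * t i s)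
          + maxOf (fun i => a i - 2 * L * t i s)) := by
        refine Finset.sum_le_sum fun s _ => mul_le_mul_of_nonneg_left ?_ (by linarith [hp s])
        refine maxOf_contraction (fun i j => ?_) a
        have := h i j s
        rw [← mul_sub, abs_mul, abs_of_pos (by norm_num : (0 : ℝ) < 2)]
        linarith
    _ = _ := by
        rw [Fintype.sum_prod_type]
        refine Finset.sum_congr rfl fun s _ => ?_
        simp only [Fintype.sum_bool, sgn, if_true, one_mul, Bool.false_eq_true, if_false]
        rw [mul_add]
        simp only [neg_mul, one_mul, mul_neg, ← sub_eq_add_neg]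

/-- Symmetrization and contraction for one-sided deviations of an empirical process. -/
theorem prodExp_maxOf_le (hp : ∀ s, 0 ≤ p s) (hp1 : ∑ s, p s = 1) {L : ℝ} {g t : I → S → ℝ}
    (h : ∀ i j s, |g i s - g j s| ≤ L * |t i s - t j s|) (n : ℕ) (a : I → ℝ) :
    prodExp p n (fun z => maxOf fun i => a i + ∑ k, (∑ s', p s' * g i s' - g i (z k)))
      ≤ prodExp (fun v : S × Bool => p v.1 / 2) n
        (fun v => maxOf fun i => a i + 2 * L * ∑ k, sgn (v k).2 * t i (v k).1) := by
  induction n generalizing a with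
  | zero => simp [prodExp_zero]
  | succ n ih =>
    have hq : ∀ v : S × Bool, 0 ≤ p v.1 / 2 := fun v => by linarith [hp v.1]
    rw [prodExp_succ, prodExp_succ_inner]
    simp only [Fin.sum_univ_succ, Fin.cons_zero, Fin.cons_succ]
    calc ∑ s, p s * prodExp p n (fun z => maxOf fun i => a i +
          (∑ s', p s' * g i s' - g i s + ∑ k, (∑ s', p s' * g i s' - g i (z k))))
        ≤ ∑ s, p s * prodExp (fun v : S × Bool => p v.1 / 2) n (fun v => maxOf fun i => a i +
          (∑ s', p s' * g i s' - g i s) + 2 * L * ∑ k, sgn (v k).2 * t i (v k).1) := by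
          refine Finset.sum_le_sum fun s _ => mul_le_mul_of_nonneg_left ?_ (hp s)
          simp only [← add_assoc]
          -- The offset carries the centred term of the first coordinate, which is symmetrized
          -- afterwards; hence the induction is over all `a`.
          exact ih fun i => a i + (∑ s', p s' * g i s' - g i s)
      _ = prodExp (fun v : S × Bool => p v.1 / 2) n (fun v => ∑ s, p s * maxOf fun i =>
            (a i + 2 * L * ∑ k, sgn (v k).2 * t i (v k).1)
              + (∑ s', p s' * g i s' - g i s)) := by
          rw [prodExp_sum]
          refine Finset.sum_congr rfl fun s _ => ?_
          rw [prodExp_const_mul]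
          simp only [add_right_comm]
      _ ≤ _ := by
          refine prodExp_mono hq fun v => ?_
          refine (sum_maxOf_le hp hp1 h _).trans (le_of_eq ?_)
          refine Finset.sum_congr rfl fun s _ => ?_
          congr 3
          funext i
          ring

/-- Variance bound for the one-sided deviations of an empirical process indexed by nonnegative
functions. -/
theorem variance_maxOf_le (hp : ∀ s, 0 ≤ p s) (hp1 : ∑ s, p s = 1) {M T : ℝ} (hM : 0 ≤ M)
    {g : I → S → ℝ} (hg0 : ∀ i s, 0 ≤ g i s) (hgM : ∀ i s, g i s ≤ M)
    (hT : ∀ i, ∑ s, p s * g i s ≤ T) (n : ℕ) (F : (Fin n → S) → ℝ)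
    (hF : F = fun z => maxOf fun i => ∑ k, (∑ s', p s' * g i s' - g i (z k))) :
    prodExp p n (fun z => (F z - prodExp p n F) ^ 2) ≤ n * (M * T) := by
  refine (efron_stein hp hp1 F).trans ?_
  rw [← prodExp_const (p := p) (n := n) hp1 (n * (M * T))]
  refine prodExp_mono hp fun z => ?_
  obtain ⟨i, hi⟩ := exists_maxOf fun i => ∑ k, (∑ s', p s' * g i s' - g i (z k))
  have hFz : F z = ∑ k, (∑ s', p s' * g i s' - g i (z k)) := by rw [hF]; exact hi
  -- The index `i` is optimal for `z`, so changing coordinate `k` to `s` lowers the maximum by at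
  -- most g i s - g i (z k) ≤ g i s. As `i` does not depend on `s`, averaging over `s` gives M T
  -- without a supremum inside the mean.
  have key : ∀ k s, max (F z - F (Function.update z k s)) 0 ^ 2 ≤ M * g i s := by
    intro k s
    have h1 : F (Function.update z k s)
        ≥ ∑ k', (∑ s', p s' * g i s' - g i (Function.update z k s k')) := by
      rw [hF]
      exact le_maxOf (fun i => ∑ k', (∑ s', p s' * g i s' - g i (Function.update z k s k'))) i
    have h2 : ∑ k', (∑ s', p s' * g i s' - g i (z k'))
        - ∑ k', (∑ s', p s' * g i s' - g i (Function.update z k s k')) = g i s - g i (z k) := by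
      rw [← Finset.sum_sub_distrib, Finset.sum_eq_single k]
      · simp
      · intro b _ hb
        rw [Function.update_of_ne hb]; ring
      · simp
    have h3 : max (F z - F (Function.update z k s)) 0 ≤ g i s :=
      max_le (by linarith [hg0 i (z k)]) (hg0 i s)
    calc max (F z - F (Function.update z k s)) 0 ^ 2 ≤ g i s ^ 2 :=
          pow_le_pow_left₀ (le_max_right _ _) h3 2
      _ ≤ M * g i s := by
          rw [sq]
          exact mul_le_mul_of_nonneg_right (hgM i s) (hg0 i s)
  calc ∑ k, ∑ s, p s * max (F z - F (Function.update z k s)) 0 ^ 2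
      ≤ ∑ _k : Fin n, M * T := by
        refine Finset.sum_le_sum fun k _ => ?_
        calc ∑ s, p s * max (F z - F (Function.update z k s)) 0 ^ 2
            ≤ ∑ s, p s * (M * g i s) :=
              Finset.sum_le_sum fun s _ => mul_le_mul_of_nonneg_left (key k s) (hp s)
          _ = M * ∑ s, p s * g i s := by
              rw [Finset.mul_sum]; exact Finset.sum_congr rfl fun _ _ => by ring
          _ ≤ M * T := mul_le_mul_of_nonneg_left (hT i) hM
    _ = n * (M * T) := by simp

end Symmetrization

/-- Uniform lower-tail bound for the empirical means of a family of nonnegative functions. -/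
theorem prodExp_deviation_le {S J : Type*} [Fintype S] {p : S → ℝ} (hp : ∀ s, 0 ≤ p s)
    (hp1 : ∑ s, p s = 1) {L M T : ℝ} (hM : 0 ≤ M) (hT0 : 0 < T) {n : ℕ} (hn : 1 ≤ n)
    {g t : J → S → ℝ} (hg0 : ∀ i s, 0 ≤ g i s) (hgM : ∀ i s, g i s ≤ M)
    (hT : ∀ i, ∑ s, p s * g i s ≤ T)
    (hLip : ∀ i j s, |g i s - g j s| ≤ L * |t i s - t j s|)
    (B : (Fin n → S × Bool) → ℝ) (hB : ∀ i v, 2 * L * ∑ k, sgn (v k).2 * t i (v k).1 ≤ B v)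
    (hBT : prodExp (fun v : S × Bool => p v.1 / 2) n B ≤ n * T / 16) :
    prodExp p n (Set.indicator
      {z | ∃ i, n * T / 8 ≤ ∑ k, (∑ s', p s' * g i s' - g i (z k))} 1) ≤ 256 * M / (n * T) := by
  classical
  have hn' : (0 : ℝ) < n := by exact_mod_cast hn
  set A : Set (Fin n → S) := {z | ∃ i, n * T / 8 ≤ ∑ k, (∑ s', p s' * g i s' - g i (z k))}
  by_cases hJ : Nonempty J
  · obtain ⟨j₀⟩ := hJ
    have : Nonempty (Fin n → S) := by
      by_contra hne
      rw [not_nonempty_iff] at hne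
      have : IsEmpty S := by
        by_contra hS
        rw [not_isEmpty_iff] at hS
        exact hne.elim fun _ => hS.some
      simp at hp1
    -- Each bad sample selects a witness. The range of `φ` is finite, so the possibly infinite
    -- family is replaced by a finite maximum that still detects every bad sample.
    set φ : (Fin n → S) → J := fun z => if h : z ∈ A then h.choose else j₀ with hφ
    set F : (Fin n → S) → ℝ := fun z => maxOf fun w : Fin n → S =>
      ∑ k, (∑ s', p s' * g (φ w) s' - g (φ w) (z k)) with hF
    have hV := variance_maxOf_le hp hp1 hM (fun w => hg0 (φ w)) (fun w => hgM (φ w))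
      (fun w => hT (φ w)) n F hF
    have hE : prodExp p n F ≤ n * T / 16 := by
      have h1 := prodExp_maxOf_le hp hp1 (fun w w' => hLip (φ w) (φ w')) n
        (fun _ : Fin n → S => 0)
      simp only [zero_add] at h1
      refine h1.trans (le_trans (prodExp_mono (fun v => by linarith [hp v.1]) fun v => ?_) hBT)
      obtain ⟨w, hw⟩ := exists_maxOf fun w : Fin n → S =>
        2 * L * ∑ k, sgn (v k).2 * t (φ w) (v k).1
      rw [hw]
      exact hB _ _
    refine (chebyshev_prodExp hp (t := n * T / 16) (by positivity) hE hV A ?_).trans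
      (le_of_eq ?_)
    · intro z hz
      have h1 : n * T / 8 ≤ ∑ k, (∑ s', p s' * g (φ z) s' - g (φ z) (z k)) := by
        have : φ z = hz.choose := dif_pos hz
        rw [this]
        exact hz.choose_spec
      have h2 := le_maxOf (fun w : Fin n → S =>
        ∑ k, (∑ s', p s' * g (φ w) s' - g (φ w) (z k))) z
      have h3 : ∑ k, (∑ s', p s' * g (φ z) s' - g (φ z) (z k)) ≤ F z := h2
      linarith
    · field_simp
      norm_num
  · rw [not_nonempty_iff] at hJ
    have : A = ∅ := by
      ext z
      simp [A]
    rw [this, Set.indicator_empty]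
    have h0 : prodExp p n (fun _ => 0) = 0 := prodExp_const hp1 0
    rw [h0]
    positivity

/-! ### Moments of sums of independent centred unit vectors. -/

section Moments

variable {S H : Type*} [Fintype S] {q : S → ℝ} [NormedAddCommGroup H] [InnerProductSpace ℝ H]
  {τ : S → H}

theorem sum_mul_inner_eq_zero (h0 : ∑ s, q s • τ s = 0) (x : H) :
    ∑ s, q s * inner ℝ x (τ s) = 0 := by
  simp only [← inner_smul_right]
  rw [← inner_sum, h0, inner_zero_right]

theorem norm_add_unit_sq {x y : H} (hx : ‖x‖ = 1) :
    ‖x + y‖ ^ 2 = ‖y‖ ^ 2 + 1 + 2 * inner ℝ y x := by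
  rw [add_comm, norm_add_sq_real, hx]; ring

theorem prodExp_norm_sum_sq (hq1 : ∑ s, q s = 1) (h0 : ∑ s, q s • τ s = 0)
    (h1 : ∀ s, ‖τ s‖ = 1) (n : ℕ) :
    prodExp q n (fun v => ‖∑ k, τ (v k)‖ ^ 2) = n := by
  induction n with
  | zero => simp [prodExp_zero]
  | succ n ih =>
    rw [prodExp_succ_inner]
    simp only [Fin.sum_univ_succ, Fin.cons_zero, Fin.cons_succ]
    have : ∀ y : H, ∑ s, q s * ‖τ s + y‖ ^ 2 = ‖y‖ ^ 2 + 1 := by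
      intro y
      have h2 : ∀ s, q s * ‖τ s + y‖ ^ 2
          = (‖y‖ ^ 2 + 1) * q s + 2 * (q s * inner ℝ y (τ s)) := by
        intro s; rw [norm_add_unit_sq (h1 s)]; ring
      simp only [h2, Finset.sum_add_distrib, ← Finset.mul_sum, hq1, sum_mul_inner_eq_zero h0]
      ring
    simp only [this]
    rw [prodExp_add, ih, prodExp_const hq1]
    push_cast
    ring

/-- Expanding the square of ‖y‖² + 1 + 2⟨y, τ⟩, the term linear in τ has mean zero and
Cauchy-Schwarz bounds 4⟨y, τ⟩² by 4‖y‖². The increment 6n + 1 is below 3(n + 1)² - 3n². -/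
theorem prodExp_norm_sum_pow_four_le (hq : ∀ s, 0 ≤ q s) (hq1 : ∑ s, q s = 1)
    (h0 : ∑ s, q s • τ s = 0) (h1 : ∀ s, ‖τ s‖ = 1) (n : ℕ) :
    prodExp q n (fun v => ‖∑ k, τ (v k)‖ ^ 4) ≤ 3 * n ^ 2 := by
  induction n with
  | zero => simp [prodExp_zero]
  | succ n ih =>
    rw [prodExp_succ_inner]
    simp only [Fin.sum_univ_succ, Fin.cons_zero, Fin.cons_succ]
    have key : ∀ y : H, ∑ s, q s * ‖τ s + y‖ ^ 4 ≤ ‖y‖ ^ 4 + (6 * ‖y‖ ^ 2 + 1) := by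
      intro y
      have h2 : ∀ s, q s * ‖τ s + y‖ ^ 4
          ≤ (‖y‖ ^ 4 + (6 * ‖y‖ ^ 2 + 1)) * q s
            + 4 * (‖y‖ ^ 2 + 1) * (q s * inner ℝ y (τ s)) := by
        intro s
        have h3 : ‖τ s + y‖ ^ 4 = (‖τ s + y‖ ^ 2) ^ 2 := by ring
        have h4 : inner ℝ y (τ s) ^ 2 ≤ ‖y‖ ^ 2 := by
          have := abs_real_inner_le_norm y (τ s)
          rw [h1, mul_one] at this
          rw [← sq_abs]
          exact pow_le_pow_left₀ (abs_nonneg _) this 2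
        rw [h3, norm_add_unit_sq (h1 s)]
        have h5 : (‖y‖ ^ 2 + 1 + 2 * inner ℝ y (τ s)) ^ 2
            ≤ ‖y‖ ^ 4 + (6 * ‖y‖ ^ 2 + 1) + 4 * (‖y‖ ^ 2 + 1) * inner ℝ y (τ s) := by
          nlinarith
        calc _ ≤ q s * (‖y‖ ^ 4 + (6 * ‖y‖ ^ 2 + 1) + 4 * (‖y‖ ^ 2 + 1) * inner ℝ y (τ s)) :=
              mul_le_mul_of_nonneg_left h5 (hq s)
          _ = _ := by ring
      refine (Finset.sum_le_sum fun s _ => h2 s).trans (le_of_eq ?_)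
      rw [Finset.sum_add_distrib, ← Finset.mul_sum, ← Finset.mul_sum, hq1,
        sum_mul_inner_eq_zero h0]
      ring
    refine (prodExp_mono hq fun z => key _).trans ?_
    rw [prodExp_add, prodExp_add, prodExp_const_mul, prodExp_norm_sum_sq hq1 h0 h1,
      prodExp_const hq1]
    push_cast
    nlinarith

/-- Khinchin-type lower bound for the mean norm of a sum of independent centered unit vectors. -/
theorem prodExp_norm_sum_ge (hq : ∀ s, 0 ≤ q s) (hq1 : ∑ s, q s = 1)
    (h0 : ∑ s, q s • τ s = 0) (h1 : ∀ s, ‖τ s‖ = 1) {n : ℕ} (hn : 1 ≤ n) :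
    n / 3 ≤ prodExp q n (fun v => ‖∑ k, τ (v k)‖) ^ 2 := by
  have hn' : (0 : ℝ) < n := by exact_mod_cast hn
  set c : ℝ := √(3 * n) with hc
  have hc0 : 0 < c := Real.sqrt_pos.2 (by positivity)
  have hc2 : c ^ 2 = 3 * n := Real.sq_sqrt (by positivity)
  -- A lower bound for y by a combination of y² and y⁴, touching at y = c. The choice c² = 3n is the
  -- ratio of the available bounds for the fourth and second moments, and optimizes the result.
  have hpt : ∀ y : ℝ, 0 ≤ y → 3 / 2 * c ^ 2 * y ^ 2 + (-(1 / 2)) * y ^ 4 ≤ c ^ 3 * y := by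
    intro y hy
    have : c ^ 3 * y - (3 / 2 * c ^ 2 * y ^ 2 + (-(1 / 2)) * y ^ 4)
        = y / 2 * ((y - c) ^ 2 * (y + 2 * c)) := by ring
    have : 0 ≤ y / 2 * ((y - c) ^ 2 * (y + 2 * c)) := by positivity
    linarith
  have h2 := prodExp_mono hq fun v : Fin n → S => hpt ‖∑ k, τ (v k)‖ (norm_nonneg _)
  rw [prodExp_add, prodExp_const_mul, prodExp_const_mul, prodExp_const_mul,
    prodExp_norm_sum_sq hq1 h0 h1] at h2
  have h4 := prodExp_norm_sum_pow_four_le hq hq1 h0 h1 n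
  set E := prodExp q n (fun v => ‖∑ k, τ (v k)‖)
  have h5 : 3 * (n : ℝ) ^ 2 ≤ c ^ 3 * E := by rw [hc2] at h2; nlinarith
  have h6 : (n : ℝ) ≤ c * E := by
    have : c ^ 3 * E = 3 * n * (c * E) := by rw [← hc2]; ring
    rw [this] at h5
    have : 3 * (n : ℝ) * n ≤ 3 * n * (c * E) := by linarith
    exact le_of_mul_le_mul_left this (by positivity)
  have h7 : (n : ℝ) ^ 2 ≤ c ^ 2 * E ^ 2 := by
    rw [← mul_pow]; exact pow_le_pow_left₀ hn'.le h6 2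
  rw [hc2] at h7
  have : (n : ℝ) * n ≤ n * (3 * E ^ 2) := by linarith
  have := le_of_mul_le_mul_left this hn'
  linarith

end Moments

open Matrix

/-- Frobenius inner product. -/
def frob {m₁ m₂ : ℕ} (A B : Matrix (Fin m₁) (Fin m₂) ℝ) : ℝ := ∑ k, ∑ l, A k l * B k l

/-! ### Frobenius, operator and nuclear norms; decomposability. -/

section Norms

variable {m₁ m₂ : ℕ}

theorem frob_eq_trace (A B : Matrix (Fin m₁) (Fin m₂) ℝ) : frob A B = (Aᵀ * B).trace := by
  simp only [frob, Matrix.trace, Matrix.mul_apply, Matrix.diag, Matrix.transpose_apply]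
  exact Finset.sum_comm

theorem frob_comm (A B : Matrix (Fin m₁) (Fin m₂) ℝ) : frob A B = frob B A := by
  simp only [frob, mul_comm]

theorem frob_add_right (A B C : Matrix (Fin m₁) (Fin m₂) ℝ) :
    frob A (B + C) = frob A B + frob A C := by
  simp only [frob, Matrix.add_apply, mul_add, Finset.sum_add_distrib]

theorem frob_add_left (A B C : Matrix (Fin m₁) (Fin m₂) ℝ) :
    frob (A + B) C = frob A C + frob B C := by
  simp only [frob, Matrix.add_apply, add_mul, Finset.sum_add_distrib]

theorem frob_sub_right (A B C : Matrix (Fin m₁) (Fin m₂) ℝ) :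
    frob A (B - C) = frob A B - frob A C := by
  simp only [frob, Matrix.sub_apply, mul_sub, Finset.sum_sub_distrib]

theorem frob_neg_left (A B : Matrix (Fin m₁) (Fin m₂) ℝ) : frob (-A) B = -frob A B := by
  simp only [frob, Matrix.neg_apply, neg_mul, Finset.sum_neg_distrib]

theorem frob_self_nonneg (A : Matrix (Fin m₁) (Fin m₂) ℝ) : 0 ≤ frob A A :=
  Finset.sum_nonneg fun _ _ => Finset.sum_nonneg fun _ _ => mul_self_nonneg _

theorem eq_zero_of_frob_self_le {A : Matrix (Fin m₁) (Fin m₂) ℝ} (h : frob A A ≤ 0) : A = 0 := by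
  ext k l
  have h1 : A k l * A k l ≤ ∑ l, A k l * A k l :=
    Finset.single_le_sum (f := fun l => A k l * A k l) (fun _ _ => mul_self_nonneg _)
      (Finset.mem_univ l)
  have h2 : ∑ l, A k l * A k l ≤ frob A A :=
    Finset.single_le_sum (f := fun k => ∑ l, A k l * A k l)
      (fun _ _ => Finset.sum_nonneg fun _ _ => mul_self_nonneg _) (Finset.mem_univ k)
  exact mul_self_eq_zero.1 (le_antisymm (by linarith) (mul_self_nonneg _))

theorem frob_mul_mul_left (P : Matrix (Fin m₁) (Fin m₁) ℝ) (Q : Matrix (Fin m₂) (Fin m₂) ℝ)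
    (A B : Matrix (Fin m₁) (Fin m₂) ℝ) : frob (P * A * Q) B = frob A (Pᵀ * B * Qᵀ) := by
  rw [frob_eq_trace, frob_eq_trace, Matrix.transpose_mul, Matrix.transpose_mul,
    Matrix.mul_assoc, Matrix.trace_mul_comm]
  simp only [Matrix.mul_assoc]

theorem frob_eq_sum_inner (b : OrthonormalBasis (Fin m₂) ℝ (EuclideanSpace ℝ (Fin m₂)))
    (A B : Matrix (Fin m₁) (Fin m₂) ℝ) :
    frob A B = ∑ j, inner ℝ (Matrix.toEuclideanLin A (b j)) (Matrix.toEuclideanLin B (b j)) := by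
  have h : ∀ (C : Matrix (Fin m₁) (Fin m₂) ℝ) (x : EuclideanSpace ℝ (Fin m₂)) (k : Fin m₁),
      Matrix.toEuclideanLin C x k = inner ℝ (WithLp.toLp 2 (C k)) x := by
    intro C x k
    simp [Matrix.toLpLin_apply, Matrix.mulVec, dotProduct, PiLp.inner_apply, mul_comm]
  have h2 : ∀ k, ∑ l, A k l * B k l
      = inner ℝ (WithLp.toLp 2 (A k) : EuclideanSpace ℝ (Fin m₂)) (WithLp.toLp 2 (B k)) := by
    intro k
    simp [PiLp.inner_apply, mul_comm]
  have h3 : ∀ j, inner ℝ (Matrix.toEuclideanLin A (b j)) (Matrix.toEuclideanLin B (b j))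
      = ∑ k, inner ℝ (WithLp.toLp 2 (A k) : EuclideanSpace ℝ (Fin m₂)) (b j)
          * inner ℝ (b j) (WithLp.toLp 2 (B k) : EuclideanSpace ℝ (Fin m₂)) := by
    intro j
    rw [PiLp.inner_apply]
    refine Finset.sum_congr rfl fun k _ => ?_
    rw [h, h, real_inner_comm (WithLp.toLp 2 (B k)) (b j), mul_comm]
    rfl
  simp only [frob, h2, h3]
  rw [Finset.sum_comm]
  exact Finset.sum_congr rfl fun k _ => (b.sum_inner_mul_inner _ _).symm

theorem le_opNorm (A : Matrix (Fin m₁) (Fin m₂) ℝ) (x : EuclideanSpace ℝ (Fin m₂)) :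
    ‖Matrix.toEuclideanLin A x‖ ≤ opNorm A * ‖x‖ :=
  (LinearMap.toContinuousLinearMap (Matrix.toEuclideanLin A)).le_opNorm x

theorem opNorm_le {A : Matrix (Fin m₁) (Fin m₂) ℝ} {c : ℝ} (hc : 0 ≤ c)
    (h : ∀ x, ‖Matrix.toEuclideanLin A x‖ ≤ c * ‖x‖) : opNorm A ≤ c :=
  ContinuousLinearMap.opNorm_le_bound _ hc h

theorem opNorm_nonneg (A : Matrix (Fin m₁) (Fin m₂) ℝ) : 0 ≤ opNorm A := norm_nonneg _

theorem opNorm_smul (c : ℝ) (A : Matrix (Fin m₁) (Fin m₂) ℝ) : opNorm (c • A) = |c| * opNorm A := by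
  simp only [opNorm, map_smul, norm_smul, Real.norm_eq_abs]

theorem opNorm_transpose (A : Matrix (Fin m₁) (Fin m₂) ℝ) : opNorm Aᵀ = opNorm A := by
  have := Matrix.l2_opNorm_conjTranspose A
  rwa [Matrix.conjTranspose_eq_transpose_of_trivial] at this

theorem frob_self_le_opNorm_sq (A : Matrix (Fin m₁) (Fin m₂) ℝ) :
    frob A A ≤ m₂ * opNorm A ^ 2 := by
  rw [frob_eq_sum_inner (EuclideanSpace.basisFun (Fin m₂) ℝ)]
  refine (Finset.sum_le_card_nsmul _ _ (opNorm A ^ 2) fun j _ => ?_).trans (by simp)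
  rw [real_inner_self_eq_norm_sq]
  refine pow_le_pow_left₀ (norm_nonneg _) ((le_opNorm A _).trans ?_) 2
  simp

theorem frob_transpose (A : Matrix (Fin m₁) (Fin m₂) ℝ) : frob Aᵀ Aᵀ = frob A A := by
  simp only [frob, Matrix.transpose_apply]
  exact Finset.sum_comm

theorem frob_self_le_min_opNorm_sq (A : Matrix (Fin m₁) (Fin m₂) ℝ) :
    frob A A ≤ (min m₁ m₂ : ℕ) * opNorm A ^ 2 := by
  rcases le_total m₁ m₂ with h | h
  · rw [min_eq_left h, ← frob_transpose, ← opNorm_transpose]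
    exact frob_self_le_opNorm_sq Aᵀ
  · rw [min_eq_right h]
    exact frob_self_le_opNorm_sq A

/-- The right singular vectors. -/
noncomputable def rightVec (B : Matrix (Fin m₁) (Fin m₂) ℝ) :
    OrthonormalBasis (Fin m₂) ℝ (EuclideanSpace ℝ (Fin m₂)) :=
  (Matrix.toEuclideanLin B).isSymmetric_adjoint_comp_self.eigenvectorBasis finrank_euclideanSpace_fin

theorem inner_apply_rightVec (B : Matrix (Fin m₁) (Fin m₂) ℝ) (i j : Fin m₂) :
    inner ℝ (Matrix.toEuclideanLin B (rightVec B i)) (Matrix.toEuclideanLin B (rightVec B j))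
      = if i = j then (Matrix.toEuclideanLin B).singularValues i ^ 2 else 0 := by
  rw [← LinearMap.adjoint_inner_left, ← LinearMap.comp_apply]
  have h := (Matrix.toEuclideanLin B).isSymmetric_adjoint_comp_self.apply_eigenvectorBasis
    finrank_euclideanSpace_fin i
  rw [← LinearMap.sq_singularValues_fin] at h
  rw [rightVec, h, inner_smul_left,
    orthonormal_iff_ite.1 (OrthonormalBasis.orthonormal _) i j]
  simp

theorem norm_apply_rightVec (B : Matrix (Fin m₁) (Fin m₂) ℝ) (i : Fin m₂) :
    ‖Matrix.toEuclideanLin B (rightVec B i)‖ = (Matrix.toEuclideanLin B).singularValues i := by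
  have h := inner_apply_rightVec B i i
  rw [real_inner_self_eq_norm_sq, if_pos rfl] at h
  exact (pow_left_inj₀ (norm_nonneg _) (LinearMap.singularValues_nonneg _ _) two_ne_zero).1 h

theorem rank_eq_finrank_range (B : Matrix (Fin m₁) (Fin m₂) ℝ) :
    B.rank = Module.finrank ℝ (LinearMap.range (Matrix.toEuclideanLin B)) := by
  rw [Matrix.toEuclideanLin_eq_toLin_orthonormal]
  exact Matrix.rank_eq_finrank_range_toLin B _ _

theorem sum_singularValues_eq (B : Matrix (Fin m₁) (Fin m₂) ℝ) {N : ℕ} (hN : B.rank ≤ N) :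
    ∑ i ∈ Finset.range N, (Matrix.toEuclideanLin B).singularValues i
      = ∑ i ∈ Finset.range B.rank, (Matrix.toEuclideanLin B).singularValues i := by
  symm
  refine Finset.sum_subset (Finset.range_mono hN) fun i _ hi => ?_
  rw [LinearMap.singularValues_eq_zero_iff_le_finrank_range, ← rank_eq_finrank_range]
  simpa using hi

theorem nuclearNorm_eq_sum_rank (B : Matrix (Fin m₁) (Fin m₂) ℝ) :
    nuclearNorm B = ∑ i ∈ Finset.range B.rank, (Matrix.toEuclideanLin B).singularValues i :=
  sum_singularValues_eq B (le_min B.rank_le_height B.rank_le_width)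

theorem nuclearNorm_eq_sum_fin (B : Matrix (Fin m₁) (Fin m₂) ℝ) :
    nuclearNorm B = ∑ i : Fin m₂, (Matrix.toEuclideanLin B).singularValues i := by
  rw [nuclearNorm_eq_sum_rank, ← sum_singularValues_eq B B.rank_le_width, Finset.sum_range]

theorem nuclearNorm_nonneg (B : Matrix (Fin m₁) (Fin m₂) ℝ) : 0 ≤ nuclearNorm B :=
  Finset.sum_nonneg fun _ _ => LinearMap.singularValues_nonneg _ _

/-- Duality between the operator norm and the nuclear norm. -/
theorem frob_le_opNorm_mul_nuclearNorm (A B : Matrix (Fin m₁) (Fin m₂) ℝ) :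
    frob A B ≤ opNorm A * nuclearNorm B := by
  rw [frob_eq_sum_inner (rightVec B), nuclearNorm_eq_sum_fin, Finset.mul_sum]
  refine Finset.sum_le_sum fun i _ => (real_inner_le_norm _ _).trans ?_
  rw [norm_apply_rightVec]
  refine mul_le_mul_of_nonneg_right ?_ (LinearMap.singularValues_nonneg _ _)
  refine (le_opNorm A _).trans ?_
  rw [(rightVec B).norm_eq_one, mul_one]

/-- The witness is the partial isometry Σ uᵢ vᵢᵀ of the singular value decomposition. With inverse
of zero equal to zero, uᵢ vanishes on the kernel. -/
theorem exists_dual (B : Matrix (Fin m₁) (Fin m₂) ℝ) :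
    ∃ A : Matrix (Fin m₁) (Fin m₂) ℝ, opNorm A ≤ 1 ∧ frob A B = nuclearNorm B := by
  set σ := (Matrix.toEuclideanLin B).singularValues
  set v := rightVec B with hv
  set u : Fin m₂ → EuclideanSpace ℝ (Fin m₁) := fun i =>
    (σ i)⁻¹ • Matrix.toEuclideanLin B (v i) with hu
  have huu : ∀ i j, inner ℝ (u i) (u j) = if i = j then (σ i)⁻¹ ^ 2 * σ i ^ 2 else 0 := by
    intro i j
    simp only [hu, inner_smul_left, inner_smul_right, hv, inner_apply_rightVec]
    split_ifs with h
    · subst h; simp [σ]; ring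
    · simp
  set A : Matrix (Fin m₁) (Fin m₂) ℝ :=
    Matrix.toEuclideanLin.symm (v.toBasis.constr ℝ u) with hA
  have hAx : ∀ x, Matrix.toEuclideanLin A x = ∑ i, v.repr x i • u i := by
    intro x
    rw [hA, LinearEquiv.apply_symm_apply, Module.Basis.constr_apply_fintype]
    rfl
  have hAv : ∀ i, Matrix.toEuclideanLin A (v i) = u i := by
    intro i
    rw [hA, LinearEquiv.apply_symm_apply]
    have := v.toBasis.constr_basis ℝ u i
    rwa [OrthonormalBasis.coe_toBasis] at this
  refine ⟨A, opNorm_le zero_le_one fun x => ?_, ?_⟩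
  · rw [one_mul, ← sq_le_sq₀ (norm_nonneg _) (norm_nonneg _), hAx, ← real_inner_self_eq_norm_sq,
      sum_inner]
    simp only [inner_sum, inner_smul_left, inner_smul_right, huu]
    simp only [mul_ite, mul_zero, Finset.sum_ite_eq, Finset.mem_univ, if_true]
    rw [← v.repr.norm_map x, EuclideanSpace.norm_sq_eq]
    refine Finset.sum_le_sum fun i _ => ?_
    rw [Real.norm_eq_abs, sq_abs]
    have h1 : (σ i)⁻¹ ^ 2 * σ i ^ 2 ≤ 1 := by
      by_cases h : σ i = 0
      · simp [h]
      · rw [← mul_pow, inv_mul_cancel₀ h, one_pow]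
    simp only [conj_trivial]
    nlinarith [sq_nonneg (v.repr x i)]
  · rw [frob_eq_sum_inner v, nuclearNorm_eq_sum_fin]
    refine Finset.sum_congr rfl fun i _ => ?_
    rw [hAv, hu, inner_smul_left, real_inner_self_eq_norm_sq, hv, norm_apply_rightVec]
    change (σ i)⁻¹ * σ i ^ 2 = σ i
    by_cases h : σ i = 0
    · simp [h]
    · field_simp

theorem nuclearNorm_add_le (A B : Matrix (Fin m₁) (Fin m₂) ℝ) :
    nuclearNorm (A + B) ≤ nuclearNorm A + nuclearNorm B := by
  obtain ⟨C, hC, h⟩ := exists_dual (A + B)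
  rw [← h, frob_add_right]
  refine add_le_add ?_ ?_
  · exact (frob_le_opNorm_mul_nuclearNorm _ _).trans
      (mul_le_of_le_one_left (nuclearNorm_nonneg _) hC)
  · exact (frob_le_opNorm_mul_nuclearNorm _ _).trans
      (mul_le_of_le_one_left (nuclearNorm_nonneg _) hC)

theorem nuclearNorm_sq_le (B : Matrix (Fin m₁) (Fin m₂) ℝ) :
    nuclearNorm B ^ 2 ≤ B.rank * frob B B := by
  rw [nuclearNorm_eq_sum_rank, frob_eq_sum_inner (rightVec B)]
  refine sq_sum_le_card_mul_sum_sq.trans ?_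
  rw [Finset.card_range]
  refine mul_le_mul_of_nonneg_left ?_ (Nat.cast_nonneg _)
  simp only [inner_apply_rightVec, if_true]
  rw [← Finset.sum_range fun i => (Matrix.toEuclideanLin B).singularValues i ^ 2]
  exact Finset.sum_le_sum_of_subset_of_nonneg (Finset.range_mono B.rank_le_width)
    fun _ _ _ => sq_nonneg _

theorem toEuclideanLin_mul_apply {m₀ : ℕ} (A : Matrix (Fin m₀) (Fin m₁) ℝ)
    (B : Matrix (Fin m₁) (Fin m₂) ℝ) (x : EuclideanSpace ℝ (Fin m₂)) :
    Matrix.toEuclideanLin (A * B) x = Matrix.toEuclideanLin A (Matrix.toEuclideanLin B x) := by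
  simp [Matrix.toLpLin_apply, Matrix.mulVec_mulVec]

/-- The orthogonal projection onto the column space of `X`. -/
theorem exists_projection (X : Matrix (Fin m₁) (Fin m₂) ℝ) :
    ∃ P : Matrix (Fin m₁) (Fin m₁) ℝ, Pᵀ = P ∧ P * P = P ∧ P * X = X ∧ P.rank ≤ X.rank := by
  set K := LinearMap.range (Matrix.toEuclideanLin X) with hK
  set P : Matrix (Fin m₁) (Fin m₁) ℝ :=
    Matrix.toEuclideanLin.symm (K.starProjection : _ →ₗ[ℝ] _) with hP
  have hPl : Matrix.toEuclideanLin P = (K.starProjection : _ →ₗ[ℝ] _) := by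
    rw [hP, LinearEquiv.apply_symm_apply]
  refine ⟨P, ?_, ?_, ?_, ?_⟩
  · have h : (Matrix.toEuclideanLin P).IsSymmetric := by
      rw [hPl]; exact K.starProjection_isSymmetric
    rw [Matrix.isSymmetric_toEuclideanLin_iff] at h
    rw [← Matrix.conjTranspose_eq_transpose_of_trivial]
    exact h
  · apply Matrix.toEuclideanLin.injective
    ext1 x
    rw [toEuclideanLin_mul_apply, hPl]
    exact Submodule.starProjection_eq_self_iff.2 (Submodule.starProjection_apply_mem _ _)
  · apply Matrix.toEuclideanLin.injective
    ext1 x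
    rw [toEuclideanLin_mul_apply, hPl]
    exact Submodule.starProjection_eq_self_iff.2 ⟨x, rfl⟩
  · rw [rank_eq_finrank_range, rank_eq_finrank_range, hPl]
    refine Submodule.finrank_mono ?_
    rintro _ ⟨x, rfl⟩
    exact Submodule.starProjection_apply_mem _ _

theorem inner_toEuclideanLin (A : Matrix (Fin m₁) (Fin m₂) ℝ) (x : EuclideanSpace ℝ (Fin m₂))
    (y : EuclideanSpace ℝ (Fin m₁)) :
    inner ℝ (Matrix.toEuclideanLin A x) y = inner ℝ x (Matrix.toEuclideanLin Aᵀ y) := by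
  rw [← Matrix.conjTranspose_eq_transpose_of_trivial, Matrix.toEuclideanLin_conjTranspose_eq_adjoint,
    LinearMap.adjoint_inner_right]

theorem norm_sq_add_projection {P : Matrix (Fin m₁) (Fin m₁) ℝ} (hPt : Pᵀ = P) (hPP : P * P = P)
    (x y : EuclideanSpace ℝ (Fin m₁)) :
    ‖Matrix.toEuclideanLin P x + Matrix.toEuclideanLin (1 - P) y‖ ^ 2
      = ‖Matrix.toEuclideanLin P x‖ ^ 2 + ‖Matrix.toEuclideanLin (1 - P) y‖ ^ 2 := by
  -- Pythagoras: the cross term vanishes because P(1 - P) = 0.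
  rw [norm_add_sq_real, inner_toEuclideanLin, hPt, ← toEuclideanLin_mul_apply, mul_sub, hPP,
    mul_one, sub_self]
  simp

/-- Block-diagonal combination of two contractions. -/
theorem opNorm_block_le {P : Matrix (Fin m₁) (Fin m₁) ℝ} {Q : Matrix (Fin m₂) (Fin m₂) ℝ}
    (hPt : Pᵀ = P) (hPP : P * P = P) (hQt : Qᵀ = Q) (hQQ : Q * Q = Q)
    {A B : Matrix (Fin m₁) (Fin m₂) ℝ} (hA : opNorm A ≤ 1) (hB : opNorm B ≤ 1) :
    opNorm (P * A * Q + (1 - P) * B * (1 - Q)) ≤ 1 := by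
  have hx : ∀ {m : ℕ} {P : Matrix (Fin m) (Fin m) ℝ}, Pᵀ = P → P * P = P →
      ∀ x : EuclideanSpace ℝ (Fin m), ‖x‖ ^ 2
        = ‖Matrix.toEuclideanLin P x‖ ^ 2 + ‖Matrix.toEuclideanLin (1 - P) x‖ ^ 2 := by
    intro m P hPt hPP x
    rw [← norm_sq_add_projection hPt hPP]
    simp [map_sub, Matrix.toLpLin_apply]
  refine opNorm_le zero_le_one fun x => ?_
  rw [one_mul, ← sq_le_sq₀ (norm_nonneg _) (norm_nonneg _), map_add, LinearMap.add_apply,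
    Matrix.mul_assoc, Matrix.mul_assoc, toEuclideanLin_mul_apply P, toEuclideanLin_mul_apply (1 - P),
    norm_sq_add_projection hPt hPP, toEuclideanLin_mul_apply A, toEuclideanLin_mul_apply B,
    hx hQt hQQ x]
  have h1 : ∀ {C : Matrix (Fin m₁) (Fin m₂) ℝ}, opNorm C ≤ 1 → ∀ y,
      ‖Matrix.toEuclideanLin C y‖ ^ 2 ≤ ‖y‖ ^ 2 := fun hC y =>
    pow_le_pow_left₀ (norm_nonneg _)
      ((le_opNorm _ y).trans (mul_le_of_le_one_left (norm_nonneg _) hC)) 2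
  have h2 := hx hPt hPP (Matrix.toEuclideanLin A (Matrix.toEuclideanLin Q x))
  have h3 := hx hPt hPP (Matrix.toEuclideanLin B (Matrix.toEuclideanLin (1 - Q) x))
  refine add_le_add ?_ ?_
  · nlinarith [h1 hA (Matrix.toEuclideanLin Q x),
      sq_nonneg ‖Matrix.toEuclideanLin (1 - P) (Matrix.toEuclideanLin A (Matrix.toEuclideanLin Q x))‖]
  · nlinarith [h1 hB (Matrix.toEuclideanLin (1 - Q) x),
      sq_nonneg ‖Matrix.toEuclideanLin P (Matrix.toEuclideanLin B (Matrix.toEuclideanLin (1 - Q) x))‖]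

theorem rank_add_le (A B : Matrix (Fin m₁) (Fin m₂) ℝ) : (A + B).rank ≤ A.rank + B.rank := by
  rw [rank_eq_finrank_range, rank_eq_finrank_range, rank_eq_finrank_range, map_add]
  refine (Submodule.finrank_mono (LinearMap.range_add_le _ _)).trans ?_
  exact Submodule.finrank_add_le_finrank_add_finrank _ _

/-- Decomposability of the nuclear norm at `X`: a perturbation `D` splits into a part `N` on which
the nuclear norm is additive with respect to `X`, and a remainder of rank at most `2 * rank X`. -/
theorem exists_decomposition (X D : Matrix (Fin m₁) (Fin m₂) ℝ) :
    ∃ N : Matrix (Fin m₁) (Fin m₂) ℝ,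
      nuclearNorm X + nuclearNorm N - nuclearNorm (D - N) ≤ nuclearNorm (X + D) ∧
      nuclearNorm (D - N) ^ 2 ≤ 2 * X.rank * frob D D := by
  obtain ⟨P, hPt, hPP, hPX, hPr⟩ := exists_projection X
  obtain ⟨Q, hQt, hQQ, hQX, hQr⟩ := exists_projection Xᵀ
  rw [Matrix.rank_transpose] at hQr
  replace hQX : X * Q = X := by
    have := congrArg Matrix.transpose hQX
    rwa [Matrix.transpose_mul, Matrix.transpose_transpose, hQt] at this
  have hP0 : P * (1 - P) = 0 := by rw [mul_sub, hPP, mul_one, sub_self]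
  have hP1 : (1 - P) * (1 - P) = 1 - P := by rw [sub_mul, hP0, one_mul, sub_zero]
  have hQ1 : (1 - Q) * (1 - Q) = 1 - Q := by
    rw [mul_sub, mul_one, sub_mul, hQQ, one_mul, sub_self, sub_zero]
  have hP1t : (1 - P)ᵀ = 1 - P := by rw [Matrix.transpose_sub, Matrix.transpose_one, hPt]
  have hQ1t : (1 - Q)ᵀ = 1 - Q := by rw [Matrix.transpose_sub, Matrix.transpose_one, hQt]
  -- `N` is the part of `D` whose row and column spaces are orthogonal to those of `X`. Gluing dual
  -- certificates of `X` and `N` into blocks gives a contraction that tests both nuclear norms at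
  -- once.
  set N := (1 - P) * D * (1 - Q) with hN
  have hNN : (1 - P) * N * (1 - Q) = N := by
    rw [hN]
    calc (1 - P) * ((1 - P) * D * (1 - Q)) * (1 - Q)
        = ((1 - P) * (1 - P)) * D * ((1 - Q) * (1 - Q)) := by simp only [Matrix.mul_assoc]
      _ = _ := by rw [hP1, hQ1]
  refine ⟨N, ?_, ?_⟩
  · obtain ⟨A, hA, hAX⟩ := exists_dual X
    obtain ⟨B, hB, hBN⟩ := exists_dual N
    have h1 : frob (P * A * Q + (1 - P) * B * (1 - Q)) (X + D) ≤ nuclearNorm (X + D) :=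
      (frob_le_opNorm_mul_nuclearNorm _ _).trans
        (mul_le_of_le_one_left (nuclearNorm_nonneg _) (opNorm_block_le hPt hPP hQt hQQ hA hB))
    have h2 : frob ((1 - P) * B * (1 - Q)) (X + D) = nuclearNorm N := by
      rw [frob_mul_mul_left, hP1t, hQ1t, Matrix.mul_add, Matrix.add_mul, ← hN, Matrix.sub_mul 1 P X, Matrix.one_mul, hPX,
        sub_self, Matrix.zero_mul, zero_add, hBN]
    have h3 : frob (P * A * Q) (X + D) = nuclearNorm X + frob (P * A * Q) (D - N) := by
      have hX : frob (P * A * Q) X = nuclearNorm X := by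
        rw [frob_mul_mul_left, hPt, hQt, hPX, hQX, hAX]
      have hN0 : frob (P * A * Q) N = 0 := by
        rw [frob_mul_mul_left, hPt, hQt, ← hNN]
        have : P * ((1 - P) * N * (1 - Q)) * Q = (P * (1 - P)) * (N * (1 - Q) * Q) := by
          simp only [Matrix.mul_assoc]
        rw [this, hP0, Matrix.zero_mul]
        simp [frob]
      rw [frob_add_right, hX, frob_sub_right, hN0, sub_zero]
    have h4 : -nuclearNorm (D - N) ≤ frob (P * A * Q) (D - N) := by
      have hop : opNorm (-(P * A * Q)) ≤ 1 := by
        have h0 : opNorm (0 : Matrix (Fin m₁) (Fin m₂) ℝ) ≤ 1 := by simp [opNorm]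
        have := opNorm_block_le hPt hPP hQt hQQ hA h0
        rw [Matrix.mul_zero, Matrix.zero_mul, add_zero] at this
        rw [← neg_one_smul ℝ, opNorm_smul]
        simpa using this
      have := (frob_le_opNorm_mul_nuclearNorm (-(P * A * Q)) (D - N)).trans
        (mul_le_of_le_one_left (nuclearNorm_nonneg _) hop)
      rw [frob_neg_left] at this
      linarith
    rw [frob_add_left, h2, h3] at h1
    linarith
  · refine (nuclearNorm_sq_le _).trans ?_
    have hr : (D - N).rank ≤ 2 * X.rank := by
      -- Each summand has a factor of rank at most that of `X`, whence the 2.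
      have : D - N = P * D + (1 - P) * D * Q := by
        rw [hN, Matrix.mul_sub ((1 - P) * D), Matrix.mul_one, Matrix.sub_mul 1 P D, Matrix.one_mul]
        abel
      rw [this]
      refine (rank_add_le _ _).trans ?_
      have h1 := (Matrix.rank_mul_le_left P D).trans hPr
      have h2 := (Matrix.rank_mul_le_right ((1 - P) * D) Q).trans hQr
      omega
    have hF : frob (D - N) (D - N) ≤ frob D D := by
      have h1 : frob N D = frob N N := by
        conv_lhs => rw [← hNN]
        rw [frob_mul_mul_left, hP1t, hQ1t]
      have h2 : frob (D - N) (D - N) = frob D D - frob N N := by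
        rw [frob_sub_right, frob_comm _ D, frob_comm _ N, frob_sub_right, frob_sub_right,
          frob_comm D N, h1]
        ring
      rw [h2]
      linarith [frob_self_nonneg N]
    have hr' : ((D - N).rank : ℝ) ≤ 2 * X.rank := by exact_mod_cast hr
    exact mul_le_mul hr' hF (frob_self_nonneg _) (by positivity)

theorem eq_zero_of_nuclearNorm_le {A : Matrix (Fin m₁) (Fin m₂) ℝ} (h : nuclearNorm A ≤ 0) :
    A = 0 := by
  have h0 : nuclearNorm A = 0 := le_antisymm h (nuclearNorm_nonneg A)
  refine eq_zero_of_frob_self_le ((frob_le_opNorm_mul_nuclearNorm A A).trans ?_)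
  rw [h0, mul_zero]

end Norms

/-! ### Scalar loss, Bregman divergence and the link constants. -/

/-- Negative log-likelihood of one label. -/
noncomputable def loss (f : ℝ → ℝ) (b : Bool) (x : ℝ) : ℝ :=
  if b = true then -Real.log (f x) else -Real.log (1 - f x)

/-- Derivative of `loss`. -/
noncomputable def lossDeriv (f : ℝ → ℝ) (b : Bool) (x : ℝ) : ℝ :=
  if b = true then -(deriv f x / f x) else deriv f x / (1 - f x)

/-- Bregman divergence of `loss`. -/
noncomputable def breg (f : ℝ → ℝ) (b : Bool) (x₀ x : ℝ) : ℝ :=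
  loss f b x - loss f b x₀ - lossDeriv f b x₀ * (x - x₀)

/-- Kullback-Leibler divergence between two Bernoulli laws. -/
noncomputable def klTerm (p q : ℝ) : ℝ :=
  p * Real.log (p / q) + (1 - p) * Real.log ((1 - p) / (1 - q))

theorem log_div_ge {p q : ℝ} (hp : 0 < p) (hq : 0 < q) :
    2 * p - 2 * (√p * √q) ≤ p * Real.log (p / q) := by
  have hp' := Real.sqrt_pos.2 hp
  have hq' := Real.sqrt_pos.2 hq
  have h1 : Real.log (p / q) = -(2 * Real.log (√q / √p)) := by
    rw [Real.log_div hp.ne' hq.ne', Real.log_div hq'.ne' hp'.ne', Real.log_sqrt hp.le,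
      Real.log_sqrt hq.le]
    ring
  -- The inequality log x ≤ x - 1 at x = √(q/p) is what produces the Hellinger affinity √p √q.
  have h2 := Real.log_le_sub_one_of_pos (div_pos hq' hp')
  have h3 : p * (√q / √p) = √p * √q := by
    rw [← mul_div_assoc, div_eq_iff hp'.ne']
    linear_combination (-√q) * Real.mul_self_sqrt hp.le
  rw [h1]
  nlinarith [mul_le_mul_of_nonneg_left h2 hp.le]

/-- The Kullback-Leibler divergence dominates the squared Hellinger distance. -/
theorem klTerm_ge {p q : ℝ} (hp : 0 < p ∧ p < 1) (hq : 0 < q ∧ q < 1) :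
    ((√p - √(1 - p)) - (√q - √(1 - q))) ^ 2 / 2 ≤ klTerm p q := by
  have hp1 : 0 < 1 - p := by linarith [hp.2]
  have hq1 : 0 < 1 - q := by linarith [hq.2]
  have h1 := log_div_ge hp.1 hq.1
  have h2 := log_div_ge hp1 hq1
  rw [klTerm]
  nlinarith [sq_nonneg ((√p - √q) + (√(1 - p) - √(1 - q))), Real.sq_sqrt hp.1.le,
    Real.sq_sqrt hq.1.le, Real.sq_sqrt hp1.le, Real.sq_sqrt hq1.le]

section Link

variable {f : ℝ → ℝ} {γ : ℝ}

theorem constK_le {x : ℝ} (hpos : ∀ x, |x| ≤ γ → 0 < f x ∧ f x < 1) (hx : |x| ≤ γ) :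
    constK f γ ≤ deriv f x ^ 2 / (8 * f x * (1 - f x)) := by
  refine ciInf_le (f := fun x : Set.Icc (-γ) γ => deriv f x ^ 2 / (8 * f x * (1 - f x)))
    ⟨0, ?_⟩ (⟨x, abs_le.1 hx⟩ : Set.Icc (-γ) γ)
  rintro _ ⟨y, rfl⟩
  have hy := hpos y (abs_le.2 y.2)
  have : 0 < 1 - f y := by linarith
  have := hy.1
  positivity

theorem hasDerivAt_loss {x : ℝ} (hpos : ∀ x, |x| ≤ γ → 0 < f x ∧ f x < 1)
    (hdiff : ∀ x, |x| ≤ γ → DifferentiableAt ℝ f x) (hx : |x| ≤ γ) (b : Bool) :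
    HasDerivAt (loss f b) (lossDeriv f b x) x := by
  have hf := (hdiff x hx).hasDerivAt
  have h := hpos x hx
  cases b
  · have h1 := ((hf.const_sub 1).log (by linarith)).neg
    have h2 : lossDeriv f false x = -(-deriv f x / (1 - f x)) := by simp [lossDeriv, neg_div]
    rw [h2]
    exact h1
  · exact (hf.log h.1.ne').neg

theorem breg_nonneg {x₀ x : ℝ} (hpos : ∀ x, |x| ≤ γ → 0 < f x ∧ f x < 1)
    (hdiff : ∀ x, |x| ≤ γ → DifferentiableAt ℝ f x) {b : Bool}
    (hconv : ConvexOn ℝ (Set.Icc (-γ) γ) (loss f b)) (hx₀ : |x₀| ≤ γ) (hx : |x| ≤ γ) :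
    0 ≤ breg f b x₀ x := by
  have hd := hasDerivAt_loss hpos hdiff hx₀ b
  rcases lt_trichotomy x₀ x with h | h | h
  · have := hconv.le_slope_of_hasDerivAt (abs_le.1 hx₀) (abs_le.1 hx) h hd
    rw [slope_def_field, le_div_iff₀ (by linarith)] at this
    rw [breg]; linarith
  · simp [breg, h]
  · have := hconv.slope_le_of_hasDerivAt (abs_le.1 hx) (abs_le.1 hx₀) h hd
    rw [slope_def_field, div_le_iff₀ (by linarith)] at this
    rw [breg]; linarith

theorem lossDeriv_mono {x y : ℝ} (hpos : ∀ x, |x| ≤ γ → 0 < f x ∧ f x < 1)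
    (hdiff : ∀ x, |x| ≤ γ → DifferentiableAt ℝ f x) {b : Bool}
    (hconv : ConvexOn ℝ (Set.Icc (-γ) γ) (loss f b)) (hx : |x| ≤ γ) (hy : |y| ≤ γ)
    (hxy : x ≤ y) : lossDeriv f b x ≤ lossDeriv f b y := by
  rcases hxy.eq_or_lt with h | h
  · rw [h]
  · have h1 := breg_nonneg hpos hdiff hconv hx hy
    have h2 := breg_nonneg hpos hdiff hconv hy hx
    rw [breg] at h1 h2
    have : 0 ≤ (lossDeriv f b y - lossDeriv f b x) * (y - x) := by linarith
    have := nonneg_of_mul_nonneg_left this (sub_pos.2 h)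
    linarith

/-- A real supremum defaults to 0 when unbounded, and `deriv f` need not be continuous. Boundedness
comes from convexity: the derivative of the loss is monotone, hence controlled by its values at ±γ.
-/
theorem abs_lossDeriv_le (hγ : 0 < γ) (hpos : ∀ x, |x| ≤ γ → 0 < f x ∧ f x < 1)
    (hdiff : ∀ x, |x| ≤ γ → DifferentiableAt ℝ f x)
    (hconv : ∀ b, ConvexOn ℝ (Set.Icc (-γ) γ) (loss f b)) (b : Bool) {x : ℝ} (hx : |x| ≤ γ) :
    |lossDeriv f b x| ≤ constL f γ := by
  have habs : |γ| ≤ γ := (abs_of_pos hγ).le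
  have habs' : |-γ| ≤ γ := by rwa [abs_neg]
  have hbd : ∀ b, ∃ C, ∀ y : Set.Icc (-γ) γ, |lossDeriv f b y| ≤ C := by
    intro b
    refine ⟨max |lossDeriv f b γ| |lossDeriv f b (-γ)|, fun y => ?_⟩
    have hy := abs_le.2 y.2
    rw [abs_le]
    have h1 := lossDeriv_mono hpos hdiff (hconv b) hy habs y.2.2
    have h2 := lossDeriv_mono hpos hdiff (hconv b) habs' hy y.2.1
    constructor
    · have := neg_abs_le (lossDeriv f b (-γ))
      have := le_max_right |lossDeriv f b γ| |lossDeriv f b (-γ)|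
      linarith
    · have := le_abs_self (lossDeriv f b γ)
      have := le_max_left |lossDeriv f b γ| |lossDeriv f b (-γ)|
      linarith
  have h1 : ∀ y : Set.Icc (-γ) γ, |deriv f y| / f y = |lossDeriv f true y| := by
    intro y
    simp [lossDeriv, abs_div, abs_of_pos (hpos y (abs_le.2 y.2)).1]
  have h2 : ∀ y : Set.Icc (-γ) γ, |deriv f y| / (1 - f y) = |lossDeriv f false y| := by
    intro y
    have : 0 < 1 - f y := by linarith [(hpos y (abs_le.2 y.2)).2]
    simp [lossDeriv, abs_div, abs_of_pos this]
  have hbdd : ∀ b, BddAbove (Set.range fun y : Set.Icc (-γ) γ => |lossDeriv f b y|) := by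
    intro b
    obtain ⟨C, hC⟩ := hbd b
    exact ⟨C, by rintro _ ⟨y, rfl⟩; exact hC y⟩
  rw [constL]
  simp only [h1, h2]
  cases b
  · exact (le_ciSup (hbdd false) (⟨x, abs_le.1 hx⟩ : Set.Icc (-γ) γ)).trans (le_max_right _ _)
  · exact (le_ciSup (hbdd true) (⟨x, abs_le.1 hx⟩ : Set.Icc (-γ) γ)).trans (le_max_left _ _)

theorem abs_breg_sub_le (hγ : 0 < γ) (hpos : ∀ x, |x| ≤ γ → 0 < f x ∧ f x < 1)
    (hdiff : ∀ x, |x| ≤ γ → DifferentiableAt ℝ f x)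
    (hconv : ∀ b, ConvexOn ℝ (Set.Icc (-γ) γ) (loss f b)) (b : Bool) {x₀ x y : ℝ}
    (hx₀ : |x₀| ≤ γ) (hx : |x| ≤ γ) (hy : |y| ≤ γ) :
    |breg f b x₀ x - breg f b x₀ y| ≤ 2 * constL f γ * |x - y| := by
  have h1 : ‖loss f b x - loss f b y‖ ≤ constL f γ * ‖x - y‖ :=
    Convex.norm_image_sub_le_of_norm_hasDerivWithin_le (s := Set.Icc (-γ) γ)
      (fun z hz => (hasDerivAt_loss hpos hdiff (abs_le.2 hz) b).hasDerivWithinAt)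
      (fun z hz => abs_lossDeriv_le hγ hpos hdiff hconv b (abs_le.2 hz)) (convex_Icc _ _)
      (abs_le.1 hy) (abs_le.1 hx)
  rw [Real.norm_eq_abs, Real.norm_eq_abs] at h1
  have h2 : |lossDeriv f b x₀ * (x - y)| ≤ constL f γ * |x - y| := by
    rw [abs_mul]
    exact mul_le_mul_of_nonneg_right (abs_lossDeriv_le hγ hpos hdiff hconv b hx₀) (abs_nonneg _)
  have h3 : breg f b x₀ x - breg f b x₀ y
      = (loss f b x - loss f b y) - lossDeriv f b x₀ * (x - y) := by rw [breg, breg]; ring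
  rw [h3]
  linarith [abs_sub (loss f b x - loss f b y) (lossDeriv f b x₀ * (x - y))]

theorem breg_le (hγ : 0 < γ) (hpos : ∀ x, |x| ≤ γ → 0 < f x ∧ f x < 1)
    (hdiff : ∀ x, |x| ≤ γ → DifferentiableAt ℝ f x)
    (hconv : ∀ b, ConvexOn ℝ (Set.Icc (-γ) γ) (loss f b)) (b : Bool) {x₀ x : ℝ}
    (hx₀ : |x₀| ≤ γ) (hx : |x| ≤ γ) : breg f b x₀ x ≤ 4 * γ * constL f γ := by
  have h := abs_breg_sub_le hγ hpos hdiff hconv b hx₀ hx hx₀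
  have h0 : breg f b x₀ x₀ = 0 := by simp [breg]
  have hL := (abs_nonneg _).trans (abs_lossDeriv_le hγ hpos hdiff hconv b hx₀)
  have h1 : |x - x₀| ≤ 2 * γ := (abs_sub _ _).trans (by linarith)
  rw [h0, sub_zero] at h
  calc breg f b x₀ x ≤ 2 * constL f γ * |x - x₀| := (le_abs_self _).trans h
    _ ≤ 2 * constL f γ * (2 * γ) := mul_le_mul_of_nonneg_left h1 (by linarith)
    _ = _ := by ring

/-- The linear terms cancel because the score has mean zero at the true parameter. -/
theorem mean_breg (hpos : ∀ x, |x| ≤ γ → 0 < f x ∧ f x < 1) {x₀ x : ℝ}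
    (hx₀ : |x₀| ≤ γ) (hx : |x| ≤ γ) :
    f x₀ * breg f true x₀ x + (1 - f x₀) * breg f false x₀ x = klTerm (f x₀) (f x) := by
  have h0 := hpos x₀ hx₀
  have h1 := hpos x hx
  have h2 : 1 - f x₀ ≠ 0 := by linarith
  have h3 : 1 - f x ≠ 0 := by linarith
  have h4 := h0.1.ne'
  simp only [breg, loss, lossDeriv, klTerm, if_true, Bool.false_eq_true, if_false]
  rw [Real.log_div h0.1.ne' h1.1.ne', Real.log_div h2 h3]
  field_simp
  ring

/-- Mean value theorem for √f - √(1 - f). The square of its derivative is f'²/(4f(1 - f)) plus a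
nonnegative cross term, hence at least twice `constK`. -/
theorem hellinger_ge (hpos : ∀ x, |x| ≤ γ → 0 < f x ∧ f x < 1)
    (hdiff : ∀ x, |x| ≤ γ → DifferentiableAt ℝ f x) {x y : ℝ} (hx : |x| ≤ γ) (hy : |y| ≤ γ) :
    2 * constK f γ * (x - y) ^ 2
      ≤ ((√(f x) - √(1 - f x)) - (√(f y) - √(1 - f y))) ^ 2 := by
  wlog hxy : x < y generalizing x y
  · rcases (not_lt.1 hxy).eq_or_lt with h | h
    · simp [h]
    · have := this hy hx h
      nlinarith
  have hd : ∀ z, |z| ≤ γ → HasDerivAt (fun z => √(f z) - √(1 - f z))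
      (deriv f z / (2 * √(f z)) - (-deriv f z) / (2 * √(1 - f z))) z := by
    intro z hz
    have h := hpos z hz
    have hf := (hdiff z hz).hasDerivAt
    exact (hf.sqrt h.1.ne').sub ((hf.const_sub 1).sqrt (by linarith))
  have hin : ∀ z ∈ Set.Icc x y, |z| ≤ γ := fun z hz =>
    abs_le.2 ⟨(abs_le.1 hx).1.trans hz.1, hz.2.trans (abs_le.1 hy).2⟩
  obtain ⟨c, hc, hceq⟩ := exists_hasDerivAt_eq_slope (fun z => √(f z) - √(1 - f z))
    (fun z => deriv f z / (2 * √(f z)) - (-deriv f z) / (2 * √(1 - f z))) hxy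
    (fun z hz => (hd z (hin z hz)).continuousAt.continuousWithinAt)
    (fun z hz => hd z (hin z (Set.Ioo_subset_Icc_self hz)))
  have hcγ := hin c (Set.Ioo_subset_Icc_self hc)
  have hK := constK_le hpos hcγ
  obtain ⟨hc0, hc1⟩ := hpos c hcγ
  have hc1' : 0 < 1 - f c := by linarith
  rw [eq_div_iff (by linarith)] at hceq
  have h1 : ((√(f x) - √(1 - f x)) - (√(f y) - √(1 - f y))) ^ 2
      = (deriv f c / (2 * √(f c)) - (-deriv f c) / (2 * √(1 - f c))) ^ 2 * (x - y) ^ 2 := by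
    rw [← neg_sub, neg_sq, ← hceq]; ring
  rw [h1]
  refine mul_le_mul_of_nonneg_right ?_ (sq_nonneg _)
  have hs := Real.sqrt_pos.2 hc0
  have hs' := Real.sqrt_pos.2 hc1'
  have h2 : (deriv f c / (2 * √(f c)) - (-deriv f c) / (2 * √(1 - f c))) ^ 2
      = deriv f c ^ 2 / (4 * √(f c) ^ 2) + deriv f c ^ 2 / (4 * √(1 - f c) ^ 2)
        + deriv f c ^ 2 / (2 * √(f c) * √(1 - f c)) := by
    field_simp
    ring
  rw [h2, Real.sq_sqrt hc0.le, Real.sq_sqrt hc1'.le]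
  have h3 : deriv f c ^ 2 / (4 * f c) + deriv f c ^ 2 / (4 * (1 - f c))
      = 2 * (deriv f c ^ 2 / (8 * f c * (1 - f c))) := by
    field_simp
    ring
  have h4 : 0 ≤ deriv f c ^ 2 / (2 * √(f c) * √(1 - f c)) := by positivity
  linarith

theorem klTerm_link_ge (hpos : ∀ x, |x| ≤ γ → 0 < f x ∧ f x < 1)
    (hdiff : ∀ x, |x| ≤ γ → DifferentiableAt ℝ f x) {x y : ℝ} (hx : |x| ≤ γ) (hy : |y| ≤ γ) :
    constK f γ * (x - y) ^ 2 ≤ klTerm (f x) (f y) := by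
  linarith [hellinger_ge hpos hdiff hx hy, klTerm_ge (hpos x hx) (hpos y hy)]

/-- The product of the two ratios bounded by L at the point 0 is f'²/(f(1 - f)). -/
theorem eight_constK_le (hγ : 0 < γ) (hpos : ∀ x, |x| ≤ γ → 0 < f x ∧ f x < 1)
    (hdiff : ∀ x, |x| ≤ γ → DifferentiableAt ℝ f x)
    (hconv : ∀ b, ConvexOn ℝ (Set.Icc (-γ) γ) (loss f b)) :
    8 * constK f γ ≤ constL f γ ^ 2 := by
  have h0 : |(0 : ℝ)| ≤ γ := by simpa using hγ.le
  obtain ⟨hf0, hf1⟩ := hpos 0 h0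
  have hf1' : 0 < 1 - f 0 := by linarith
  have h1 := abs_lossDeriv_le hγ hpos hdiff hconv true h0
  have h2 := abs_lossDeriv_le hγ hpos hdiff hconv false h0
  have h3 := mul_le_mul h1 h2 (abs_nonneg _) ((abs_nonneg _).trans h1)
  have h4 : |lossDeriv f true 0| * |lossDeriv f false 0|
      = 8 * (deriv f 0 ^ 2 / (8 * f 0 * (1 - f 0))) := by
    simp only [lossDeriv, if_true, Bool.false_eq_true, if_false, abs_neg, abs_div,
      abs_of_pos hf0, abs_of_pos hf1']
    rw [← sq_abs]
    field_simp
  have := constK_le hpos h0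
  rw [sq]
  linarith

/-- Compares the uniform bound 4γL on `breg` with L²/K, the quantity in the deviation scale. Since
√f - √(1 - f) takes values in [-1, 1], `hellinger_ge` across [-γ, γ] forces Kγ² ≤ 1/2; then (4γK)² ≤
8K ≤ L². -/
theorem four_mul_constL_le (hγ : 0 < γ) (hpos : ∀ x, |x| ≤ γ → 0 < f x ∧ f x < 1)
    (hdiff : ∀ x, |x| ≤ γ → DifferentiableAt ℝ f x)
    (hconv : ∀ b, ConvexOn ℝ (Set.Icc (-γ) γ) (loss f b)) (hK : 0 < constK f γ) :
    4 * γ * constL f γ ≤ constL f γ ^ 2 / constK f γ := by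
  have habs : |γ| ≤ γ := (abs_of_pos hγ).le
  have habs' : |-γ| ≤ γ := by rwa [abs_neg]
  have hL : 0 ≤ constL f γ :=
    (abs_nonneg _).trans (abs_lossDeriv_le hγ hpos hdiff hconv true habs)
  have h1 := hellinger_ge hpos hdiff habs' habs
  have hb : ∀ x, |x| ≤ γ → |√(f x) - √(1 - f x)| ≤ 1 := by
    intro x hx
    obtain ⟨hx0, hx1⟩ := hpos x hx
    have h2 : √(f x) ≤ 1 := Real.sqrt_le_one.2 hx1.le
    have h3 : √(1 - f x) ≤ 1 := Real.sqrt_le_one.2 (by linarith)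
    rw [abs_le]
    constructor <;> linarith [Real.sqrt_nonneg (f x), Real.sqrt_nonneg (1 - f x)]
  have h2 : |(√(f (-γ)) - √(1 - f (-γ))) - (√(f γ) - √(1 - f γ))| ≤ 2 :=
    (abs_sub _ _).trans (by linarith [hb _ habs, hb _ habs'])
  have h3 := pow_le_pow_left₀ (abs_nonneg _) h2 2
  rw [sq_abs] at h3
  have h4 : constK f γ * γ ^ 2 ≤ 1 / 2 := by nlinarith
  have h5 := eight_constK_le hγ hpos hdiff hconv
  rw [le_div_iff₀ hK]
  have h6 : (4 * γ * constK f γ) ^ 2 ≤ constL f γ ^ 2 := by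
    calc (4 * γ * constK f γ) ^ 2 = 16 * constK f γ * (constK f γ * γ ^ 2) := by ring
      _ ≤ 16 * constK f γ * (1 / 2) := mul_le_mul_of_nonneg_left h4 (by positivity)
      _ ≤ _ := by linarith
  have h7 := (pow_le_pow_iff_left₀ (by positivity) hL two_ne_zero).1 h6
  nlinarith

end Link

/-! ### Likelihood expansion and consequences of optimality. -/

section Likelihood

variable {m₁ m₂ n : ℕ} {f : ℝ → ℝ} {γ : ℝ}

theorem negLogLik_eq (w : Fin n → Fin m₁ × Fin m₂) (y : Fin n → Bool)
    (X : Matrix (Fin m₁) (Fin m₂) ℝ) :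
    negLogLik f w y X = 1 / (n : ℝ) * ∑ i, loss f (y i) (X (w i).1 (w i).2) := by
  rw [negLogLik, neg_mul, ← mul_neg, ← Finset.sum_neg_distrib]
  congr 1
  refine Finset.sum_congr rfl fun i _ => ?_
  rw [loss]
  split_ifs <;> rfl

/-- Convexity of the likelihood for all data includes the case where every observation is the same
cell with the same label; on constant matrices it is then the scalar loss. -/
theorem convexOn_loss (hn : 1 ≤ n) (kl : Fin m₁ × Fin m₂)
    (hconv : ∀ (w : Fin n → Fin m₁ × Fin m₂) (y : Fin n → Bool),
      ConvexOn ℝ (box m₁ m₂ γ) (negLogLik f w y)) (b : Bool) :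
    ConvexOn ℝ (Set.Icc (-γ) γ) (loss f b) := by
  have hn' : (n : ℝ) ≠ 0 := by exact_mod_cast (by omega : n ≠ 0)
  have key : ∀ x, negLogLik f (fun _ : Fin n => kl) (fun _ => b) (Matrix.of fun _ _ => x)
      = loss f b x := by
    intro x
    rw [negLogLik_eq]
    simp [hn']
  have hmem : ∀ x ∈ Set.Icc (-γ) γ, (Matrix.of fun _ _ => x) ∈ box m₁ m₂ γ :=
    fun x hx _ _ => abs_le.2 hx
  refine ⟨convex_Icc _ _, fun x hx y hy s t hs ht hst => ?_⟩
  have h := (hconv (fun _ => kl) fun _ => b).2 (hmem x hx) (hmem y hy) hs ht hst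
  rw [key, key] at h
  have h2 : s • (Matrix.of fun _ _ => x : Matrix (Fin m₁) (Fin m₂) ℝ)
      + t • (Matrix.of fun _ _ => y) = Matrix.of fun _ _ => s • x + t • y := by
    ext k l
    simp
  rw [h2, key] at h
  exact h

theorem gradMat_negLogLik (hpos : ∀ x, |x| ≤ γ → 0 < f x ∧ f x < 1)
    (hdiff : ∀ x, |x| ≤ γ → DifferentiableAt ℝ f x) {X : Matrix (Fin m₁) (Fin m₂) ℝ}
    (hX : ∀ k l, |X k l| ≤ γ) (w : Fin n → Fin m₁ × Fin m₂) (y : Fin n → Bool)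
    (k : Fin m₁) (l : Fin m₂) :
    gradMat (negLogLik f w y) X k l
      = 1 / (n : ℝ) * ∑ i, if w i = (k, l) then lossDeriv f (y i) (X k l) else 0 := by
  have hfun : (fun t : ℝ => negLogLik f w y (X + Matrix.single k l t))
      = fun t => 1 / (n : ℝ) * ∑ i,
        loss f (y i) (X (w i).1 (w i).2 + if w i = (k, l) then t else 0) := by
    funext t
    rw [negLogLik_eq]
    congr 1
    refine Finset.sum_congr rfl fun i _ => ?_
    congr 1
    rw [Matrix.add_apply, Matrix.single_apply]
    congr 1
    by_cases h : w i = (k, l)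
    · simp [h]
    · rw [if_neg h, if_neg]
      rintro ⟨h1, h2⟩
      exact h (Prod.ext h1.symm h2.symm)
  rw [gradMat, Matrix.of_apply, hfun]
  refine HasDerivAt.deriv (HasDerivAt.const_mul _ (HasDerivAt.fun_sum fun i _ => ?_))
  by_cases h : w i = (k, l)
  · simp only [h, if_true]
    have h1 : HasDerivAt (loss f (y i)) (lossDeriv f (y i) (X k l)) (X k l + 0) := by
      rw [add_zero]
      exact hasDerivAt_loss hpos hdiff (hX k l) (y i)
    exact h1.comp_const_add (X k l) 0
  · simp only [h, if_false]
    exact hasDerivAt_const _ _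

theorem frob_gradMat (hpos : ∀ x, |x| ≤ γ → 0 < f x ∧ f x < 1)
    (hdiff : ∀ x, |x| ≤ γ → DifferentiableAt ℝ f x) {X : Matrix (Fin m₁) (Fin m₂) ℝ}
    (hX : ∀ k l, |X k l| ≤ γ) (w : Fin n → Fin m₁ × Fin m₂) (y : Fin n → Bool)
    (D : Matrix (Fin m₁) (Fin m₂) ℝ) :
    frob (gradMat (negLogLik f w y) X) D
      = 1 / (n : ℝ) * ∑ i, lossDeriv f (y i) (X (w i).1 (w i).2) * D (w i).1 (w i).2 := by
  simp only [frob, gradMat_negLogLik hpos hdiff hX, mul_assoc, ← Finset.mul_sum, Finset.sum_mul]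
  congr 1
  rw [← Fintype.sum_prod_type' (f := fun k l => ∑ i,
    (if w i = (k, l) then lossDeriv f (y i) (X k l) else 0) * D k l), Finset.sum_comm]
  refine Finset.sum_congr rfl fun i _ => ?_
  simp [ite_mul]

theorem negLogLik_sub (hpos : ∀ x, |x| ≤ γ → 0 < f x ∧ f x < 1)
    (hdiff : ∀ x, |x| ≤ γ → DifferentiableAt ℝ f x) {X X' : Matrix (Fin m₁) (Fin m₂) ℝ}
    (hX : ∀ k l, |X k l| ≤ γ) (w : Fin n → Fin m₁ × Fin m₂) (y : Fin n → Bool) :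
    negLogLik f w y X' - negLogLik f w y X
      = frob (gradMat (negLogLik f w y) X) (X' - X)
        + 1 / (n : ℝ) * ∑ i, breg f (y i) (X (w i).1 (w i).2) (X' (w i).1 (w i).2) := by
  rw [frob_gradMat hpos hdiff hX, negLogLik_eq, negLogLik_eq, ← mul_sub, ← mul_add,
    ← Finset.sum_sub_distrib, ← Finset.sum_add_distrib]
  congr 1
  refine Finset.sum_congr rfl fun i _ => ?_
  rw [breg, Matrix.sub_apply]
  ring

/-- Deterministic consequences of the optimality of the penalized estimator. -/
theorem IsPenalizedMLE.basic_inequality {lam : ℝ} (hlam : 0 < lam)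
    (hpos : ∀ x, |x| ≤ γ → 0 < f x ∧ f x < 1)
    (hdiff : ∀ x, |x| ≤ γ → DifferentiableAt ℝ f x)
    (hconv : ∀ b, ConvexOn ℝ (Set.Icc (-γ) γ) (loss f b)) {X Xhat : Matrix (Fin m₁) (Fin m₂) ℝ}
    (hX : ∀ k l, |X k l| ≤ γ) {w : Fin n → Fin m₁ × Fin m₂} {y : Fin n → Bool}
    (hgrad : 2 * opNorm (gradMat (negLogLik f w y) X) ≤ lam)
    (h : IsPenalizedMLE f γ lam w y Xhat) :
    nuclearNorm (Xhat - X) ^ 2 ≤ 32 * X.rank * frob (Xhat - X) (Xhat - X) ∧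
    (1 / (n : ℝ) * ∑ i, breg f (y i) (X (w i).1 (w i).2) (Xhat (w i).1 (w i).2)) ^ 2
      ≤ 9 / 2 * lam ^ 2 * X.rank * frob (Xhat - X) (Xhat - X) := by
  set D := Xhat - X with hD
  set S := 1 / (n : ℝ) * ∑ i, breg f (y i) (X (w i).1 (w i).2) (Xhat (w i).1 (w i).2) with hS
  have hS0 : 0 ≤ S := mul_nonneg (by positivity) (Finset.sum_nonneg fun i _ =>
    breg_nonneg hpos hdiff (hconv _) (hX _ _) (h.1 _ _))
  obtain ⟨N, hN1, hN2⟩ := exists_decomposition X D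
  have hXD : X + D = Xhat := by rw [hD]; abel
  rw [hXD] at hN1
  have h1 : negLogLik f w y Xhat + lam * nuclearNorm Xhat
      ≤ negLogLik f w y X + lam * nuclearNorm X := h.2 (show X ∈ box m₁ m₂ γ from hX)
  have h2 := negLogLik_sub hpos hdiff hX w y (X' := Xhat)
  have h3 : -(lam / 2 * nuclearNorm D) ≤ frob (gradMat (negLogLik f w y) X) D := by
    have h4 := frob_le_opNorm_mul_nuclearNorm (-gradMat (negLogLik f w y) X) D
    have h5 : opNorm (-gradMat (negLogLik f w y) X) ≤ lam / 2 := by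
      rw [← neg_one_smul ℝ, opNorm_smul]
      simp only [abs_neg, abs_one, one_mul]
      linarith
    have h6 := mul_le_mul_of_nonneg_right h5 (nuclearNorm_nonneg D)
    rw [frob_neg_left] at h4
    linarith
  have h4 : nuclearNorm D ≤ nuclearNorm (D - N) + nuclearNorm N := by
    have := nuclearNorm_add_le (D - N) N
    rwa [sub_add_cancel] at this
  have hA := nuclearNorm_nonneg (D - N)
  have hB := nuclearNorm_nonneg N
  -- The gradient costs at most half of lam times the nuclear norm of `D`, and decomposability
  -- returns all of lam times that of `N`. As S ≥ 0, `N` is at most 3 times D - N in nuclear norm;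
  -- with the factor 2 in `hN2` this yields 32 = 4² · 2 and 9/2 = (3/2)² · 2.
  have h5 : S ≤ lam / 2 * (3 * nuclearNorm (D - N) - nuclearNorm N) := by
    have h6 := mul_le_mul_of_nonneg_left hN1 hlam.le
    have h7 := mul_le_mul_of_nonneg_left h4 hlam.le
    rw [← hS, ← hD] at h2
    linarith
  have h6 : nuclearNorm N ≤ 3 * nuclearNorm (D - N) := by
    have : 0 ≤ lam / 2 * (3 * nuclearNorm (D - N) - nuclearNorm N) := hS0.trans h5
    have := nonneg_of_mul_nonneg_right this (by linarith)
    linarith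
  constructor
  · have h7 : nuclearNorm D ≤ 4 * nuclearNorm (D - N) := by linarith
    have h8 := pow_le_pow_left₀ (nuclearNorm_nonneg D) h7 2
    linarith
  · have h7 : S ≤ 3 / 2 * lam * nuclearNorm (D - N) := by
      have := mul_nonneg hlam.le hB
      linarith
    have h8 := pow_le_pow_left₀ hS0 h7 2
    have h9 := mul_le_mul_of_nonneg_left hN2 (sq_nonneg lam)
    linarith

end Likelihood

/-! ### Transfer from the probability space to finite sums. -/

section Law

variable {S Ω : Type*} [MeasurableSpace S] [MeasurableSingletonClass S]
  [MeasurableSpace Ω] {P : Measure Ω} {n : ℕ} {q : S → ℝ} {V : Ω → Fin n → S}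

theorem integral_eq_prodExp [Fintype S] [IsProbabilityMeasure P] (hV : Measurable V) (h : ∀ v, P.real (V ⁻¹' {v}) = ∏ i, q (v i))
    (G : (Fin n → S) → ℝ) : ∫ ω, G (V ω) ∂P = prodExp q n G := by
  have hG : Measurable G := measurable_of_finite G
  have : IsProbabilityMeasure (P.map V) := Measure.isProbabilityMeasure_map hV.aemeasurable
  rw [← integral_map hV.aemeasurable hG.aestronglyMeasurable,
    integral_fintype (Integrable.of_finite)]
  refine Finset.sum_congr rfl fun v _ => ?_
  rw [map_measureReal_apply hV (measurableSet_singleton v), h, smul_eq_mul]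

theorem measureReal_preimage_eq_prodExp [Fintype S] [IsProbabilityMeasure P] (hV : Measurable V)
    (h : ∀ v, P.real (V ⁻¹' {v}) = ∏ i, q (v i)) (A : Set (Fin n → S)) :
    P.real (V ⁻¹' A) = prodExp q n (A.indicator 1) := by
  rw [← integral_eq_prodExp hV h, ← integral_indicator_one (hV A.toFinite.measurableSet)]
  rfl

/-- The joint law of independent variables with values in a finite type. -/
theorem measureReal_eq_prod {X : Fin n → Ω → S}
    (hind : iIndepFun X P) (hq : ∀ i s, P.real (X i ⁻¹' {s}) = q s) (v : Fin n → S) :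
    P.real ((fun ω i => X i ω) ⁻¹' {v}) = ∏ i, q (v i) := by
  have h1 : (fun ω i => X i ω) ⁻¹' {v} = ⋂ i ∈ Finset.univ, X i ⁻¹' {v i} := by
    ext ω
    simp [funext_iff]
  rw [h1, measureReal_def, hind.measure_inter_preimage_eq_mul Finset.univ
    (fun i _ => measurableSet_singleton _), ENNReal.toReal_prod]
  exact Finset.prod_congr rfl fun i _ => hq i (v i)

end Law

/-! ### Law of the sample, size of Σ_R, and deviations at a fixed scale. -/

section Sample

variable {m₁ m₂ n : ℕ} {Ω : Type*} [MeasurableSpace Ω] {P : Measure Ω}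
  {Pi : Measure (Fin m₁ × Fin m₂)} {f : ℝ → ℝ} {γ : ℝ}
  {Xbar : Matrix (Fin m₁) (Fin m₂) ℝ} {W : Fin n → Ω → Fin m₁ × Fin m₂} {Y : Fin n → Ω → Bool}
  {ε : Fin n → Ω → ℝ}

/-- Probability weights of one observation. -/
noncomputable def obsWeight (Pi : Measure (Fin m₁ × Fin m₂)) (f : ℝ → ℝ)
    (Xbar : Matrix (Fin m₁) (Fin m₂) ℝ) (s : (Fin m₁ × Fin m₂) × Bool) : ℝ :=
  Pi.real {s.1} * if s.2 = true then f (Xbar s.1.1 s.1.2) else 1 - f (Xbar s.1.1 s.1.2)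

theorem obsWeight_nonneg (hlink : ∀ x, 0 ≤ f x ∧ f x ≤ 1) (s : (Fin m₁ × Fin m₂) × Bool) :
    0 ≤ obsWeight Pi f Xbar s := by
  refine mul_nonneg measureReal_nonneg ?_
  have := hlink (Xbar s.1.1 s.1.2)
  split_ifs <;> linarith

theorem sum_obsWeight_mul (g : (Fin m₁ × Fin m₂) × Bool → ℝ) :
    ∑ s, obsWeight Pi f Xbar s * g s = ∑ k, ∑ l, Pi.real {(k, l)} *
      (f (Xbar k l) * g ((k, l), true) + (1 - f (Xbar k l)) * g ((k, l), false)) := by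
  rw [Fintype.sum_prod_type, Fintype.sum_prod_type]
  refine Finset.sum_congr rfl fun k _ => Finset.sum_congr rfl fun l _ => ?_
  simp only [Fintype.sum_bool, obsWeight, if_true, Bool.false_eq_true, if_false]
  ring

theorem sum_obsWeight [IsProbabilityMeasure Pi] : ∑ s, obsWeight Pi f Xbar s = 1 := by
  have h := sum_obsWeight_mul (Pi := Pi) (f := f) (Xbar := Xbar) fun _ => 1
  simp only [mul_one, add_sub_cancel] at h
  rw [h, ← Fintype.sum_prod_type' (f := fun k l => Pi.real {(k, l)})]
  simp

theorem IsBinarySample.measureReal_preimage (hs : IsBinarySample P Pi f Xbar W Y) (i : Fin n)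
    (s : (Fin m₁ × Fin m₂) × Bool) :
    P.real ((fun ω => (W i ω, Y i ω)) ⁻¹' {s}) = obsWeight Pi f Xbar s := by
  obtain ⟨⟨k, l⟩, b⟩ := s
  have h : (fun ω => (W i ω, Y i ω)) ⁻¹' {((k, l), b)} = {ω | W i ω = (k, l) ∧ Y i ω = b} := by
    ext ω; simp [Prod.ext_iff]
  rw [h]
  cases b
  · simpa [obsWeight] using hs.law_false i k l
  · simpa [obsWeight] using hs.law_true i k l

theorem IsBinarySample.measurable_pair (hs : IsBinarySample P Pi f Xbar W Y) (i : Fin n) :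
    Measurable fun ω => (W i ω, Y i ω) :=
  (hs.measurable_W i).prodMk (hs.measurable_Y i)

theorem IsBinarySample.measurable_sample (hs : IsBinarySample P Pi f Xbar W Y) :
    Measurable fun ω (i : Fin n) => (W i ω, Y i ω) :=
  measurable_pi_lambda _ hs.measurable_pair

theorem IsBinarySample.measureReal_sample (hs : IsBinarySample P Pi f Xbar W Y)
    (z : Fin n → (Fin m₁ × Fin m₂) × Bool) :
    P.real ((fun ω i => (W i ω, Y i ω)) ⁻¹' {z}) = ∏ i, obsWeight Pi f Xbar (z i) :=
  measureReal_eq_prod hs.indep hs.measureReal_preimage z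

theorem IsRademacherSequence.ae_eq [IsProbabilityMeasure P] (hε : IsRademacherSequence P ε) :
    ∀ᵐ ω ∂P, ∀ i, ε i ω = sgn (decide (ε i ω = 1)) := by
  rw [ae_all_iff]
  intro i
  have h1 : MeasurableSet {ω | ε i ω = 1} := hε.measurable i (measurableSet_singleton 1)
  have h2 : MeasurableSet {ω | ε i ω = -1} := hε.measurable i (measurableSet_singleton (-1))
  have hdisj : Disjoint {ω | ε i ω = 1} {ω | ε i ω = -1} := by
    rw [Set.disjoint_left]
    intro ω ha hb
    change ε i ω = 1 at ha
    change ε i ω = -1 at hb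
    linarith
  have h3 : P.real ({ω | ε i ω = 1} ∪ {ω | ε i ω = -1}) = 1 := by
    rw [measureReal_union hdisj h2, hε.prob_one, hε.prob_neg_one]; norm_num
  have h4 : P.real ({ω | ε i ω = 1} ∪ {ω | ε i ω = -1})ᶜ = 0 := by
    rw [probReal_compl_eq_one_sub (h1.union h2), h3, sub_self]
  rw [measureReal_eq_zero_iff] at h4
  filter_upwards [mem_ae_iff.2 h4] with ω hω
  rcases hω with h | h
  · change ε i ω = 1 at h
    simp [h, sgn]
  · change ε i ω = -1 at h
    have : ¬ ε i ω = 1 := by rw [h]; norm_num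
    simp only [this, decide_false, sgn, Bool.false_eq_true, if_false]
    exact h

/-- The matrix of signed counts. -/
noncomputable def signedCount (v : Fin n → ((Fin m₁ × Fin m₂) × Bool) × Bool) :
    Matrix (Fin m₁) (Fin m₂) ℝ :=
  ∑ i, sgn (v i).2 • Matrix.single (v i).1.1.1 (v i).1.1.2 (1 : ℝ)

theorem integral_opNorm_sigmaR [IsProbabilityMeasure P] (hs : IsBinarySample P Pi f Xbar W Y)
    (hε : IsRademacherSequence P ε)
    (hindep : IndepFun (fun ω i => ε i ω) (fun ω i => (W i ω, Y i ω)) P) :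
    ∫ ω, opNorm (sigmaR (fun i => W i ω) (fun i => ε i ω)) ∂P
      = 1 / (n : ℝ) * prodExp (fun v => obsWeight Pi f Xbar v.1 / 2) n
          (fun v => opNorm (signedCount v)) := by
  -- Signs are encoded as bits, so that observations and signs together form one sample from a
  -- finite type; almost surely nothing is lost.
  set V : Ω → Fin n → ((Fin m₁ × Fin m₂) × Bool) × Bool :=
    fun ω i => ((W i ω, Y i ω), decide (ε i ω = 1)) with hVdef
  have hbit : Measurable fun x : ℝ => decide (x = 1) :=
    measurable_to_bool (by
      have : (fun x : ℝ => decide (x = 1)) ⁻¹' {true} = {1} := by ext; simp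
      rw [this]
      exact measurableSet_singleton 1)
  have hbits : Measurable fun (x : Fin n → ℝ) i => decide (x i = 1) :=
    measurable_pi_lambda _ fun i => hbit.comp (measurable_pi_apply i)
  have hV : Measurable V := measurable_pi_lambda _ fun i =>
    (hs.measurable_pair i).prodMk (hbit.comp (hε.measurable i))
  have hlawbit : ∀ i (b : Bool), P.real ((fun ω => decide (ε i ω = 1)) ⁻¹' {b}) = 1 / 2 := by
    intro i b
    have h1 : (fun ω => decide (ε i ω = 1)) ⁻¹' {true} = {ω | ε i ω = 1} := by ext; simp
    cases b
    · have h2 : (fun ω => decide (ε i ω = 1)) ⁻¹' {false} = {ω | ε i ω = 1}ᶜ := by ext; simp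
      have h3 : MeasurableSet {ω | ε i ω = 1} := hε.measurable i (measurableSet_singleton 1)
      rw [h2, probReal_compl_eq_one_sub h3, hε.prob_one]
      norm_num
    · rw [h1, hε.prob_one]
  have hlaw : ∀ v, P.real (V ⁻¹' {v}) = ∏ i, obsWeight Pi f Xbar (v i).1 / 2 := by
    intro v
    have h1 : V ⁻¹' {v} = (fun ω i => decide (ε i ω = 1)) ⁻¹' {fun i => (v i).2}
        ∩ (fun ω i => (W i ω, Y i ω)) ⁻¹' {fun i => (v i).1} := by
      ext ω
      simp only [hVdef, Set.mem_preimage, Set.mem_singleton_iff, funext_iff, Set.mem_inter_iff,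
        ← forall_and]
      refine forall_congr' fun i => ?_
      rw [Prod.ext_iff, and_comm]
    have h2 : IndepFun (fun ω i => decide (ε i ω = 1)) (fun ω i => (W i ω, Y i ω)) P :=
      hindep.comp hbits measurable_id
    have h3 := measureReal_eq_prod
      (hε.indep.comp (fun _ x => decide (x = 1)) fun _ => hbit) (q := fun _ => 1 / 2)
      hlawbit (fun i => (v i).2)
    have h4 := hs.measureReal_sample fun i => (v i).1
    rw [h1, measureReal_def, h2.measure_inter_preimage_eq_mul _ _ (measurableSet_singleton _)
      (measurableSet_singleton _), ENNReal.toReal_mul, ← measureReal_def, ← measureReal_def, h4]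
    erw [h3]
    rw [← Finset.prod_mul_distrib]
    exact Finset.prod_congr rfl fun i _ => by ring
  rw [← integral_eq_prodExp hV hlaw, ← integral_const_mul]
  refine integral_congr_ae ?_
  filter_upwards [hε.ae_eq] with ω hω
  rw [sigmaR, opNorm_smul, abs_of_nonneg (by positivity)]
  congr 2
  exact Finset.sum_congr rfl fun i _ => by rw [hω i]

theorem signedCount_apply (v : Fin n → ((Fin m₁ × Fin m₂) × Bool) × Bool) (k : Fin m₁)
    (l : Fin m₂) :
    signedCount v k l = ∑ i, sgn (v i).2 * if (v i).1.1 = (k, l) then 1 else 0 := by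
  rw [signedCount, Matrix.sum_apply]
  refine Finset.sum_congr rfl fun i _ => ?_
  rw [Matrix.smul_apply, smul_eq_mul, Matrix.single_apply]
  simp [Prod.ext_iff]

theorem frob_signedCount (v : Fin n → ((Fin m₁ × Fin m₂) × Bool) × Bool)
    (D : Matrix (Fin m₁) (Fin m₂) ℝ) :
    frob (signedCount v) D = ∑ i, sgn (v i).2 * D (v i).1.1.1 (v i).1.1.2 := by
  simp only [frob, signedCount_apply, Finset.sum_mul]
  rw [← Fintype.sum_prod_type' (f := fun k l => ∑ i,
    (sgn (v i).2 * if (v i).1.1 = (k, l) then 1 else 0) * D k l), Finset.sum_comm]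
  refine Finset.sum_congr rfl fun i _ => ?_
  simp

theorem prodExp_opNorm_signedCount_ge [IsProbabilityMeasure Pi] (hlink : ∀ x, 0 ≤ f x ∧ f x ≤ 1)
    (hn : 1 ≤ n) :
    n / 3 ≤ (min m₁ m₂ : ℕ) * prodExp (fun v => obsWeight Pi f Xbar v.1 / 2) n
      (fun v => opNorm (signedCount v)) ^ 2 := by
  set q : ((Fin m₁ × Fin m₂) × Bool) × Bool → ℝ := fun v => obsWeight Pi f Xbar v.1 / 2
  -- Signed matrix units are centred unit vectors for the Frobenius norm, which is at most √min(m₁,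
  -- m₂) times the operator norm.
  set τ : ((Fin m₁ × Fin m₂) × Bool) × Bool → EuclideanSpace ℝ (Fin m₁ × Fin m₂) :=
    fun v => sgn v.2 • EuclideanSpace.single v.1.1 (1 : ℝ)
  have hq : ∀ v, 0 ≤ q v := fun v => by
    have := obsWeight_nonneg (Pi := Pi) (Xbar := Xbar) hlink v.1
    change 0 ≤ obsWeight Pi f Xbar v.1 / 2
    linarith
  have hq1 : ∑ v, q v = 1 := by
    rw [Fintype.sum_prod_type]
    simp only [q, Fintype.sum_bool, add_halves]
    exact sum_obsWeight
  have h0 : ∑ v, q v • τ v = 0 := by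
    rw [Fintype.sum_prod_type]
    simp [q, τ, sgn]
  have h1 : ∀ v, ‖τ v‖ = 1 := by
    rintro ⟨s, b⟩
    cases b <;> simp [τ, sgn]
  refine (prodExp_norm_sum_ge hq hq1 h0 h1 hn).trans ?_
  have hnorm : ∀ v : Fin n → ((Fin m₁ × Fin m₂) × Bool) × Bool,
      ‖∑ i, τ (v i)‖ ≤ √((min m₁ m₂ : ℕ) : ℝ) * opNorm (signedCount v) := by
    intro v
    have h2 : ‖∑ i, τ (v i)‖ ^ 2 = frob (signedCount v) (signedCount v) := by
      rw [EuclideanSpace.norm_sq_eq, Fintype.sum_prod_type, frob]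
      refine Finset.sum_congr rfl fun k _ => Finset.sum_congr rfl fun l _ => ?_
      have h3 : (∑ i, τ (v i)) (k, l) = signedCount v k l := by
        rw [signedCount_apply, WithLp.ofLp_sum, Finset.sum_apply]
        refine Finset.sum_congr rfl fun i _ => ?_
        simp [τ, eq_comm]
      rw [h3, Real.norm_eq_abs, sq_abs, sq]
    refine (pow_le_pow_iff_left₀ (norm_nonneg _)
      (mul_nonneg (Real.sqrt_nonneg _) (opNorm_nonneg _)) two_ne_zero).1 ?_
    rw [h2, mul_pow, Real.sq_sqrt (Nat.cast_nonneg _)]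
    exact frob_self_le_min_opNorm_sq _
  have h2 := prodExp_mono (n := n) hq hnorm
  rw [prodExp_const_mul] at h2
  have h3 : 0 ≤ prodExp q n (fun v => ‖∑ i, τ (v i)‖) := by
    have := prodExp_mono (n := n) hq
      (F := fun _ => 0) (G := fun v => ‖∑ i, τ (v i)‖) fun v => norm_nonneg _
    rwa [prodExp_const hq1] at this
  have h4 := pow_le_pow_left₀ h3 h2 2
  rwa [mul_pow, Real.sq_sqrt (Nat.cast_nonneg _)] at h4

/-- Population risk: the mean of the Kullback-Leibler divergence at a random entry. -/
noncomputable def popRisk (Pi : Measure (Fin m₁ × Fin m₂)) (f : ℝ → ℝ)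
    (Xbar X : Matrix (Fin m₁) (Fin m₂) ℝ) : ℝ :=
  ∑ k, ∑ l, Pi.real {(k, l)} * klTerm (f (Xbar k l)) (f (X k l))

theorem sum_obsWeight_mul_breg (hpos : ∀ x, |x| ≤ γ → 0 < f x ∧ f x < 1)
    {X : Matrix (Fin m₁) (Fin m₂) ℝ} (hXbar : ∀ k l, |Xbar k l| ≤ γ) (hX : ∀ k l, |X k l| ≤ γ) :
    ∑ s, obsWeight Pi f Xbar s * breg f s.2 (Xbar s.1.1 s.1.2) (X s.1.1 s.1.2)
      = popRisk Pi f Xbar X := by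
  rw [sum_obsWeight_mul, popRisk]
  refine Finset.sum_congr rfl fun k _ => Finset.sum_congr rfl fun l _ => ?_
  rw [← mean_breg hpos (hXbar k l) (hX k l)]

/-- Uniform deviation at one scale `T`, with `R` the mean operator norm of `sigmaR`. -/
theorem IsBinarySample.deviation_le [IsProbabilityMeasure P] [IsProbabilityMeasure Pi]
    (hs : IsBinarySample P Pi f Xbar W Y) (hn : 1 ≤ n)
    (hγ : 0 < γ) (hlink : ∀ x, 0 ≤ f x ∧ f x ≤ 1) (hpos : ∀ x, |x| ≤ γ → 0 < f x ∧ f x < 1)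
    (hdiff : ∀ x, |x| ≤ γ → DifferentiableAt ℝ f x)
    (hconv : ∀ b, ConvexOn ℝ (Set.Icc (-γ) γ) (loss f b)) (hXbar : ∀ k l, |Xbar k l| ≤ γ)
    {R ρ T : ℝ} (hR : R = 1 / (n : ℝ) * prodExp (fun v => obsWeight Pi f Xbar v.1 / 2) n
          (fun v => opNorm (signedCount v))) (hR0 : 0 ≤ R) (hρ : 0 ≤ ρ) (hT0 : 0 < T)
    (hT : 131072 * (ρ * constL f γ ^ 2 * R ^ 2) ≤ T) :
    P.real {ω | ∃ X : Matrix (Fin m₁) (Fin m₂) ℝ, (∀ k l, |X k l| ≤ γ) ∧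
        nuclearNorm (X - Xbar) ^ 2 ≤ 32 * ρ * T ∧ popRisk Pi f Xbar X ≤ T ∧
        n * T / 8 ≤ ∑ i, (popRisk Pi f Xbar X
          - breg f (Y i ω) (Xbar (W i ω).1 (W i ω).2) (X (W i ω).1 (W i ω).2))}
      ≤ 256 * (4 * γ * constL f γ) / (n * T) := by
  have hn' : (0 : ℝ) < n := by exact_mod_cast hn
  have hL : 0 ≤ constL f γ := (abs_nonneg _).trans
    (abs_lossDeriv_le hγ hpos hdiff hconv true (x := 0) (by simpa using hγ.le))
  let J := {X : Matrix (Fin m₁) (Fin m₂) ℝ // (∀ k l, |X k l| ≤ γ) ∧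
    nuclearNorm (X - Xbar) ^ 2 ≤ 32 * ρ * T ∧ popRisk Pi f Xbar X ≤ T}
  let g : J → (Fin m₁ × Fin m₂) × Bool → ℝ := fun X s =>
    breg f s.2 (Xbar s.1.1 s.1.2) (X.1 s.1.1 s.1.2)
  -- Centring at `Xbar` makes the Rademacher sum the Frobenius pairing of `signedCount` with X -
  -- Xbar, to which duality applies.
  let t : J → (Fin m₁ × Fin m₂) × Bool → ℝ := fun X s => (X.1 - Xbar) s.1.1 s.1.2
  have hmean : ∀ X : J, ∑ s, obsWeight Pi f Xbar s * g X s = popRisk Pi f Xbar X.1 :=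
    fun X => sum_obsWeight_mul_breg hpos hXbar X.2.1
  have key := prodExp_deviation_le (p := obsWeight Pi f Xbar) (obsWeight_nonneg hlink)
    sum_obsWeight (L := 2 * constL f γ) (M := 4 * γ * constL f γ) (by positivity) hT0 hn
    (g := g) (t := t)
    (fun X s => breg_nonneg hpos hdiff (hconv _) (hXbar _ _) (X.2.1 _ _))
    (fun X s => breg_le hγ hpos hdiff hconv _ (hXbar _ _) (X.2.1 _ _))
    (fun X => (hmean X).le.trans X.2.2.2)
    (fun X X' s => by
      have h := abs_breg_sub_le hγ hpos hdiff hconv s.2 (hXbar s.1.1 s.1.2)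
        (X.2.1 s.1.1 s.1.2) (X'.2.1 s.1.1 s.1.2)
      have h2 : t X s - t X' s = X.1 s.1.1 s.1.2 - X'.1 s.1.1 s.1.2 := by
        simp [t, Matrix.sub_apply]
      rw [h2]
      exact h)
    (fun v => 2 * (2 * constL f γ) * √(32 * ρ * T) * opNorm (signedCount v))
    (fun X v => by
      have h1 : ∑ i, sgn (v i).2 * t X (v i).1 = frob (signedCount v) (X.1 - Xbar) :=
        (frob_signedCount v (X.1 - Xbar)).symm
      rw [h1, mul_assoc _ √(32 * ρ * T)]
      refine mul_le_mul_of_nonneg_left ?_ (by positivity)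
      rw [mul_comm √(32 * ρ * T)]
      refine (frob_le_opNorm_mul_nuclearNorm _ _).trans
        (mul_le_mul_of_nonneg_left ?_ (opNorm_nonneg _))
      exact Real.le_sqrt_of_sq_le X.2.2.1)
    (by
      rw [prodExp_const_mul]
      have h1 : prodExp (fun v => obsWeight Pi f Xbar v.1 / 2) n
          (fun v => opNorm (signedCount v)) = n * R := by
        rw [hR]; field_simp
      rw [h1]
      -- Squaring explains the constant in `hT`: 32 · 64² = 131072.
      have h2 : √(32 * ρ * T) * (constL f γ * R) ≤ T / 64 := by
        refine (pow_le_pow_iff_left₀ (by positivity) (by positivity) two_ne_zero).1 ?_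
        rw [mul_pow, Real.sq_sqrt (by positivity)]
        have := mul_le_mul_of_nonneg_right hT hT0.le
        nlinarith
      have := mul_le_mul_of_nonneg_left h2 hn'.le
      linarith)
  rw [← measureReal_preimage_eq_prodExp hs.measurable_sample hs.measureReal_sample] at key
  refine le_trans (measureReal_mono ?_) key
  rintro ω ⟨X, h1, h2, h3, h4⟩
  exact ⟨⟨X, h1, h2, h3⟩, by rw [hmean]; exact h4⟩

theorem klTerm_nonneg {p q : ℝ} (hp : 0 < p ∧ p < 1) (hq : 0 < q ∧ q < 1) : 0 ≤ klTerm p q :=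
  le_trans (by positivity) (klTerm_ge hp hq)

theorem klDiv_le_popRisk {μ : ℝ} (hμ : 1 ≤ μ) (hm₁ : 0 < m₁) (hm₂ : 0 < m₂)
    (hPi : ∀ k l, 1 / (μ * m₁ * m₂) ≤ Pi.real {(k, l)})
    (hpos : ∀ x, |x| ≤ γ → 0 < f x ∧ f x < 1) {X : Matrix (Fin m₁) (Fin m₂) ℝ}
    (hXbar : ∀ k l, |Xbar k l| ≤ γ) (hX : ∀ k l, |X k l| ≤ γ) :
    klDiv (Xbar.map f) (X.map f) ≤ μ * popRisk Pi f Xbar X := by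
  have hm₁' : (0 : ℝ) < m₁ := by exact_mod_cast hm₁
  have hm₂' : (0 : ℝ) < m₂ := by exact_mod_cast hm₂
  have hμ0 : 0 < μ := by linarith
  have h : klDiv (Xbar.map f) (X.map f)
      = 1 / ((m₁ : ℝ) * m₂) * ∑ k, ∑ l, klTerm (f (Xbar k l)) (f (X k l)) := rfl
  rw [h, popRisk]
  simp only [Finset.mul_sum]
  refine Finset.sum_le_sum fun k _ => Finset.sum_le_sum fun l _ => ?_
  rw [← mul_assoc]
  refine mul_le_mul_of_nonneg_right ?_ (klTerm_nonneg (hpos _ (hXbar k l)) (hpos _ (hX k l)))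
  have h1 := mul_le_mul_of_nonneg_left (hPi k l) hμ0.le
  refine le_trans (le_of_eq ?_) h1
  field_simp

theorem frob_le_popRisk {μ : ℝ} (hμ : 1 ≤ μ) (hm₁ : 0 < m₁) (hm₂ : 0 < m₂)
    (hPi : ∀ k l, 1 / (μ * m₁ * m₂) ≤ Pi.real {(k, l)})
    (hpos : ∀ x, |x| ≤ γ → 0 < f x ∧ f x < 1) (hdiff : ∀ x, |x| ≤ γ → DifferentiableAt ℝ f x)
    {X : Matrix (Fin m₁) (Fin m₂) ℝ}
    (hXbar : ∀ k l, |Xbar k l| ≤ γ) (hX : ∀ k l, |X k l| ≤ γ) :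
    constK f γ * frob (X - Xbar) (X - Xbar) ≤ μ * (m₁ * m₂) * popRisk Pi f Xbar X := by
  have hm₁' : (0 : ℝ) < m₁ := by exact_mod_cast hm₁
  have hm₂' : (0 : ℝ) < m₂ := by exact_mod_cast hm₂
  have hμ0 : 0 < μ := by linarith
  simp only [frob, popRisk, Finset.mul_sum]
  refine Finset.sum_le_sum fun k _ => Finset.sum_le_sum fun l _ => ?_
  have h1 := klTerm_link_ge hpos hdiff (hXbar k l) (hX k l)
  have h2 := klTerm_nonneg (hpos _ (hXbar k l)) (hpos _ (hX k l))
  have h3 : 1 ≤ μ * (m₁ * m₂) * Pi.real {(k, l)} := by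
    have := mul_le_mul_of_nonneg_left (hPi k l) (by positivity : 0 ≤ μ * (m₁ * m₂ : ℝ))
    refine le_trans (le_of_eq ?_) this
    field_simp
  rw [← mul_assoc (μ * (m₁ * m₂ : ℝ))]
  calc constK f γ * ((X - Xbar) k l * (X - Xbar) k l)
      = constK f γ * (Xbar k l - X k l) ^ 2 := by rw [Matrix.sub_apply]; ring
    _ ≤ klTerm (f (Xbar k l)) (f (X k l)) := h1
    _ ≤ _ := le_mul_of_one_le_left h2 h3

end Sample

/-! ### Peeling over scales and conclusion. -/

theorem measureReal_iUnion_le_of_geometric {Ω : Type*} [MeasurableSpace Ω] {P : Measure Ω}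
    [IsProbabilityMeasure P] {A : ℕ → Set Ω} {c : ℝ} (hc : 0 ≤ c)
    (h : ∀ l, P.real (A l) ≤ c / 2 / 2 ^ l) : P.real (⋃ l, A l) ≤ c := by
  have hs := hasSum_geometric_two' c
  refine ENNReal.toReal_le_of_le_ofReal hc ((measure_iUnion_le A).trans ?_)
  rw [← hs.tsum_eq, ENNReal.ofReal_tsum_of_nonneg (fun l => by positivity) hs.summable]
  refine ENNReal.tsum_le_tsum fun l => ?_
  rw [← ofReal_measureReal (measure_ne_top P _)]
  exact ENNReal.ofReal_le_ofReal (h l)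

/-- Passing from a control of the deviations at every scale to a bound on the population risk. -/
theorem popRisk_le_of_deviation {m₁ m₂ n : ℕ} (hn : 1 ≤ n) {Pi : Measure (Fin m₁ × Fin m₂)}
    {f : ℝ → ℝ} {γ : ℝ} {Xbar Xhat : Matrix (Fin m₁) (Fin m₂) ℝ}
    {w : Fin n → Fin m₁ × Fin m₂} {y : Fin n → Bool} {ρ T₀ lam : ℝ} (hT₀ : 0 < T₀)
    (hdev : ∀ l : ℕ, ∀ X : Matrix (Fin m₁) (Fin m₂) ℝ, (∀ k l, |X k l| ≤ γ) →
      nuclearNorm (X - Xbar) ^ 2 ≤ 32 * ρ * (2 ^ (l + 1) * T₀) →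
      popRisk Pi f Xbar X ≤ 2 ^ (l + 1) * T₀ →
      ∑ i, (popRisk Pi f Xbar X - breg f (y i) (Xbar (w i).1 (w i).2) (X (w i).1 (w i).2))
        < n * (2 ^ (l + 1) * T₀) / 8)
    (hρ : 0 ≤ ρ) (hXhat : ∀ k l, |Xhat k l| ≤ γ)
    (hrank : Xbar.rank * frob (Xhat - Xbar) (Xhat - Xbar) ≤ ρ * popRisk Pi f Xbar Xhat)
    (hcone : nuclearNorm (Xhat - Xbar) ^ 2
      ≤ 32 * Xbar.rank * frob (Xhat - Xbar) (Xhat - Xbar))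
    (hbasic : (1 / (n : ℝ) * ∑ i, breg f (y i) (Xbar (w i).1 (w i).2) (Xhat (w i).1 (w i).2)) ^ 2
      ≤ 9 / 2 * lam ^ 2 * Xbar.rank * frob (Xhat - Xbar) (Xhat - Xbar)) :
    popRisk Pi f Xbar Xhat ≤ max T₀ (8 * ρ * lam ^ 2) := by
  have hn' : (0 : ℝ) < n := by exact_mod_cast hn
  set D := popRisk Pi f Xbar Xhat with hD
  rcases le_or_gt D T₀ with h | h
  · exact h.trans (le_max_left _ _)
  refine le_trans ?_ (le_max_right _ _)
  have hD0 : 0 < D := hT₀.trans h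
  -- The dyadic scale with 2^l T₀ ≤ D < 2^(l+1) T₀. The deviation is below an eighth of the upper
  -- end, hence below D/4.
  obtain ⟨l, hl1, hl2⟩ := exists_nat_pow_near (x := D / T₀) (y := 2)
    ((one_le_div hT₀).2 h.le) one_lt_two
  rw [le_div_iff₀ hT₀] at hl1
  rw [div_lt_iff₀ hT₀] at hl2
  have hd := hdev l Xhat hXhat (by
    have := mul_le_mul_of_nonneg_left hl2.le hρ
    linarith) hl2.le
  rw [← hD, Finset.sum_sub_distrib, Finset.sum_const, Finset.card_univ, Fintype.card_fin,
    nsmul_eq_mul] at hd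
  set Z := ∑ i, breg f (y i) (Xbar (w i).1 (w i).2) (Xhat (w i).1 (w i).2)
  have h1 : 3 / 4 * D ≤ 1 / (n : ℝ) * Z := by
    rw [one_div, inv_mul_eq_div, le_div_iff₀ hn']
    have h2 : 2 ^ (l + 1) * T₀ ≤ 2 * D := by rw [pow_succ]; linarith
    have h3 := mul_le_mul_of_nonneg_left h2 hn'.le
    linarith
  have h2 := pow_le_pow_left₀ (by positivity) h1 2
  have h3 : (3 / 4 * D) ^ 2 ≤ 9 / 2 * lam ^ 2 * (ρ * D) :=
    (h2.trans hbasic).trans (by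
      have := mul_le_mul_of_nonneg_left hrank (by positivity : 0 ≤ 9 / 2 * lam ^ 2)
      linarith)
  have h4 : D * D ≤ (8 * ρ * lam ^ 2) * D := by linarith
  exact le_of_mul_le_mul_right h4 hD0

theorem klDiv_self {m₁ m₂ : ℕ} (X : Matrix (Fin m₁) (Fin m₂) ℝ) : klDiv X X = 0 := by
  simp [klDiv]

end MatrixCompletion

theorem theorem1 :
    ∃ c : ℝ, 0 < c ∧
      ∀ {m₁ m₂ n : ℕ} (hn : 1 ≤ n)
        {Ω : Type*} [MeasurableSpace Ω] (P : Measure Ω) [IsProbabilityMeasure P]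
        (Pi : Measure (Fin m₁ × Fin m₂)) [IsProbabilityMeasure Pi]
        (f : ℝ → ℝ) (γ μ : ℝ) (Xbar : Matrix (Fin m₁) (Fin m₂) ℝ)
        (W : Fin n → Ω → Fin m₁ × Fin m₂) (Y : Fin n → Ω → Bool) (ε : Fin n → Ω → ℝ)
        (hγ : 0 < γ)
        -- the link function
        (hlink : ∀ x, 0 ≤ f x ∧ f x ≤ 1)
        (hpos : ∀ x, |x| ≤ γ → 0 < f x ∧ f x < 1)
        (hdiff : ∀ x, |x| ≤ γ → DifferentiableAt ℝ f x)
        (hK : 0 < MatrixCompletion.constK f γ)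
        -- the negative log-likelihood is convex
        (hconv : ∀ (w : Fin n → Fin m₁ × Fin m₂) (y : Fin n → Bool),
          ConvexOn ℝ (MatrixCompletion.box m₁ m₂ γ) (MatrixCompletion.negLogLik f w y))
        -- the sampling distribution and the observations
        (hμ : 1 ≤ μ)
        (hPi : ∀ k l, 1 / (μ * m₁ * m₂) ≤ Pi.real {(k, l)})
        (hsample : MatrixCompletion.IsBinarySample P Pi f Xbar W Y)
        (hε : MatrixCompletion.IsRademacherSequence P ε)
        (hindep : IndepFun (fun ω i => ε i ω) (fun ω i => (W i ω, Y i ω)) P)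
        (hX : ∀ k l, |Xbar k l| ≤ γ),
        1 - 2 / ((m₁ : ℝ) + m₂) ≤
          P.real {ω | ∀ (lam : ℝ) (Xhat : Matrix (Fin m₁) (Fin m₂) ℝ),
            0 < lam →
            2 * MatrixCompletion.opNorm (MatrixCompletion.gradMat
              (MatrixCompletion.negLogLik f (fun i => W i ω) (fun i => Y i ω)) Xbar) ≤ lam →
            MatrixCompletion.IsPenalizedMLE f γ lam (fun i => W i ω) (fun i => Y i ω) Xhat →
            MatrixCompletion.klDiv (Xbar.map f) (Xhat.map f) ≤
              8 * max
                (μ ^ 2 / MatrixCompletion.constK f γ * ((m₁ : ℝ) * m₂ * (Xbar.rank : ℝ)) *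
                  (lam ^ 2 + c * MatrixCompletion.constL f γ ^ 2 *
                    (∫ ω', MatrixCompletion.opNorm
                      (MatrixCompletion.sigmaR (fun i => W i ω') (fun i => ε i ω')) ∂P) ^ 2))
                (μ * Real.exp 1 * MatrixCompletion.constM f γ *
                  (Real.sqrt (Real.log ((m₁ : ℝ) + m₂)) / n))} := by
  -- 16384 = 131072 / 8: the threshold T₀ is written as 8 ρ c L² R².
  refine ⟨16384, by norm_num, ?_⟩
  intro m₁ m₂ n hn Ω _ P _ Pi _ f γ μ Xbar W Y ε hγ hlink hpos hdiff hK hconv hμ hPi hsample hε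
    hindep hX
  obtain ⟨kl⟩ : Nonempty (Fin m₁ × Fin m₂) := by
    by_contra h
    rw [not_nonempty_iff] at h
    have := measure_univ (μ := Pi)
    rw [Set.univ_eq_empty_iff.2 h, measure_empty] at this
    exact zero_ne_one this
  have hm₁ : 0 < m₁ := kl.1.pos
  have hm₂ : 0 < m₂ := kl.2.pos
  have hm₁' : (0 : ℝ) < m₁ := by exact_mod_cast hm₁
  have hm₂' : (0 : ℝ) < m₂ := by exact_mod_cast hm₂
  have hn' : (0 : ℝ) < n := by exact_mod_cast hn
  have hμ0 : 0 < μ := by linarith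
  have hcv := MatrixCompletion.convexOn_loss hn kl hconv
  set K := MatrixCompletion.constK f γ
  set L := MatrixCompletion.constL f γ
  have hLK : 8 * K ≤ L ^ 2 := MatrixCompletion.eight_constK_le hγ hpos hdiff hcv
  have hML : 4 * γ * L ≤ L ^ 2 / K := MatrixCompletion.four_mul_constL_le hγ hpos hdiff hcv hK
  have hL0 : 0 ≤ L := (abs_nonneg _).trans
    (MatrixCompletion.abs_lossDeriv_le hγ hpos hdiff hcv true (hX kl.1 kl.2))
  have hL2 : 0 < L ^ 2 := by linarith
  set R := ∫ ω', MatrixCompletion.opNorm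
    (MatrixCompletion.sigmaR (fun i => W i ω') (fun i => ε i ω')) ∂P
  have hR : R = 1 / (n : ℝ) * MatrixCompletion.prodExp
      (fun v => MatrixCompletion.obsWeight Pi f Xbar v.1 / 2) n
      (fun v => MatrixCompletion.opNorm (MatrixCompletion.signedCount v)) :=
    MatrixCompletion.integral_opNorm_sigmaR hsample hε hindep
  have hR0 : 0 ≤ R := integral_nonneg fun _ => MatrixCompletion.opNorm_nonneg _
  have hM0 : 0 ≤ MatrixCompletion.constM f γ := Real.iSup_nonneg fun _ => by positivity
  have hsecond : 0 ≤ μ * Real.exp 1 * MatrixCompletion.constM f γ *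
      (Real.sqrt (Real.log ((m₁ : ℝ) + m₂)) / n) := by positivity
  -- For rank 0 the scale T₀ degenerates to 0, but the cone condition then forces Xhat = Xbar for
  -- every sample.
  rcases Nat.eq_zero_or_pos Xbar.rank with hr | hr
  · refine (sub_le_self _ (by positivity)).trans ((probReal_univ (μ := P)).symm.le.trans
      (measureReal_mono fun ω _ lam Xhat hlam hgrad hhat => ?_))
    have h1 := (hhat.basic_inequality hlam hpos hdiff hcv hX hgrad).1
    rw [hr, Nat.cast_zero, mul_zero, zero_mul] at h1
    have h2 : Xhat - Xbar = 0 := MatrixCompletion.eq_zero_of_nuclearNorm_le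
      (pow_eq_zero_iff two_ne_zero |>.1 (le_antisymm h1 (sq_nonneg _))).le
    rw [sub_eq_zero.1 h2, MatrixCompletion.klDiv_self]
    have := le_max_right (μ ^ 2 / K * ((m₁ : ℝ) * m₂ * (Xbar.rank : ℝ)) *
      (lam ^ 2 + 16384 * L ^ 2 * R ^ 2)) (μ * Real.exp 1 * MatrixCompletion.constM f γ *
                  (Real.sqrt (Real.log ((m₁ : ℝ) + m₂)) / n))
    linarith
  set ρ : ℝ := Xbar.rank * (μ * (m₁ * m₂)) / K with hρ
  have hr1 : (1 : ℝ) ≤ Xbar.rank := by exact_mod_cast hr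
  have hρ0 : 0 < ρ := by positivity
  have hRlow : 1 / (3 * n) ≤ (min m₁ m₂ : ℕ) * R ^ 2 := by
    have h := MatrixCompletion.prodExp_opNorm_signedCount_ge (Pi := Pi) (Xbar := Xbar) hlink hn
    rw [hR, mul_pow, mul_left_comm, div_pow, one_pow]
    refine le_trans (le_of_eq ?_) (mul_le_mul_of_nonneg_left h (by positivity))
    field_simp
  set Q := ρ * L ^ 2 * R ^ 2 with hQ
  -- Uses d ≤ 2 max(m₁, m₂) and min · max = m₁ m₂ to turn the Khinchin bound into a lower bound on
  -- `Q` of order d/n.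
  have hdQ : L ^ 2 / K * (m₁ + m₂) / n ≤ 6 * Q := by
    have h1 : (m₁ : ℝ) + m₂ ≤ 2 * (max m₁ m₂ : ℕ) := by
      have : m₁ + m₂ ≤ 2 * max m₁ m₂ := by omega
      exact_mod_cast this
    have h2 : (min m₁ m₂ : ℕ) * ((max m₁ m₂ : ℕ) : ℝ) = m₁ * m₂ := by
      exact_mod_cast min_mul_max m₁ m₂
    have h3 : ((m₁ : ℝ) + m₂) / n ≤ 6 * ((m₁ * m₂) * R ^ 2) := by
      calc ((m₁ : ℝ) + m₂) / n ≤ 2 * (max m₁ m₂ : ℕ) / n := by gcongr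
        _ = 6 * ((max m₁ m₂ : ℕ) * (1 / (3 * n))) := by field_simp; norm_num
        _ ≤ 6 * ((max m₁ m₂ : ℕ) * ((min m₁ m₂ : ℕ) * R ^ 2)) := by gcongr
        _ = 6 * ((m₁ * m₂) * R ^ 2) := by rw [← h2]; ring
    have h4 : (1 : ℝ) ≤ Xbar.rank * μ := one_le_mul_of_one_le_of_one_le hr1 hμ
    calc L ^ 2 / K * (m₁ + m₂) / n = L ^ 2 / K * ((m₁ + m₂) / n) := by ring
      _ ≤ L ^ 2 / K * (6 * ((m₁ * m₂) * R ^ 2)) := by gcongr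
      _ ≤ (Xbar.rank * μ) * (L ^ 2 / K * (6 * ((m₁ * m₂) * R ^ 2))) :=
          le_mul_of_one_le_left (by positivity) h4
      _ = 6 * Q := by rw [hQ, hρ]; ring
  have hQ0 : 0 < Q := by
    have : 0 < L ^ 2 / K * (m₁ + m₂) / n := by positivity
    linarith
  set T₀ := 131072 * Q with hT₀
  have hT₀0 : 0 < T₀ := by positivity
  set A : ℕ → Set Ω := fun l => {ω | ∃ X : Matrix (Fin m₁) (Fin m₂) ℝ, (∀ k l, |X k l| ≤ γ) ∧
    MatrixCompletion.nuclearNorm (X - Xbar) ^ 2 ≤ 32 * ρ * (2 ^ (l + 1) * T₀) ∧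
    MatrixCompletion.popRisk Pi f Xbar X ≤ 2 ^ (l + 1) * T₀ ∧
    n * (2 ^ (l + 1) * T₀) / 8 ≤ ∑ i, (MatrixCompletion.popRisk Pi f Xbar X
      - MatrixCompletion.breg f (Y i ω) (Xbar (W i ω).1 (W i ω).2) (X (W i ω).1 (W i ω).2))}
  have hAle : ∀ l, P.real (A l) ≤ 2 / ((m₁ : ℝ) + m₂) / 2 / 2 ^ l := by
    intro l
    have hT : T₀ ≤ 2 ^ (l + 1) * T₀ :=
      le_mul_of_one_le_left hT₀0.le (one_le_pow₀ one_le_two)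
    refine (hsample.deviation_le hn hγ hlink hpos hdiff hcv hX hR hR0 hρ0.le
      (by positivity : 0 < 2 ^ (l + 1) * T₀) hT).trans ?_
    have h1 : 256 * (4 * γ * L) * (m₁ + m₂) ≤ 2 * (n * T₀) := by
      have h2 : 4 * γ * L * (m₁ + m₂) ≤ 6 * Q * n := by
        rw [div_le_iff₀ hn'] at hdQ
        exact (mul_le_mul_of_nonneg_right hML (by positivity)).trans hdQ
      have : 0 ≤ Q * n := by positivity
      rw [hT₀]
      linarith
    have h3 : 256 * (4 * γ * L) / (n * (2 ^ (l + 1) * T₀))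
        = 256 * (4 * γ * L) / (n * T₀) / 2 / 2 ^ l := by
      rw [pow_succ]; field_simp
    rw [h3]
    refine div_le_div_of_nonneg_right (div_le_div_of_nonneg_right ?_ (by norm_num)) (by positivity)
    rw [div_le_div_iff₀ (by positivity) (by positivity)]
    exact h1
  have hbad := MatrixCompletion.measureReal_iUnion_le_of_geometric (by positivity) hAle
  set G : Set Ω := {ω | ∀ (lam : ℝ) (Xhat : Matrix (Fin m₁) (Fin m₂) ℝ), _ → _ → _ → _}
  -- A cover and subadditivity suffice, so measurability of the good event is not needed.
  have hcover : Set.univ ⊆ G ∪ ⋃ l, A l := by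
    intro ω _
    by_cases hω : ω ∈ ⋃ l, A l
    · exact Or.inr hω
    refine Or.inl fun lam Xhat hlam hgrad hhat => ?_
    obtain ⟨hcone, hbasic⟩ := hhat.basic_inequality hlam hpos hdiff hcv hX hgrad
    have hfrob := MatrixCompletion.frob_le_popRisk hμ hm₁ hm₂ hPi hpos hdiff hX hhat.1
    have hrank : Xbar.rank * MatrixCompletion.frob (Xhat - Xbar) (Xhat - Xbar)
        ≤ ρ * MatrixCompletion.popRisk Pi f Xbar Xhat := by
      rw [hρ, div_mul_eq_mul_div, le_div_iff₀ hK]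
      have := mul_le_mul_of_nonneg_left hfrob (by positivity : (0 : ℝ) ≤ Xbar.rank)
      linarith
    have hpop := MatrixCompletion.popRisk_le_of_deviation hn hT₀0 (fun l X h1 h2 h3 => by
      by_contra hcon
      exact hω (Set.mem_iUnion.2 ⟨l, X, h1, h2, h3, not_lt.1 hcon⟩)) hρ0.le hhat.1 hrank hcone hbasic
    have hkl := MatrixCompletion.klDiv_le_popRisk hμ hm₁ hm₂ hPi hpos hX hhat.1
    have hmax : max T₀ (8 * ρ * lam ^ 2) ≤ 8 * ρ * (lam ^ 2 + 16384 * L ^ 2 * R ^ 2) := by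
      have e : 8 * ρ * (lam ^ 2 + 16384 * L ^ 2 * R ^ 2) = 8 * ρ * lam ^ 2 + T₀ := by
        rw [hT₀, hQ]; ring
      have : 0 ≤ 8 * ρ * lam ^ 2 := by positivity
      rw [e]
      exact max_le (by linarith) (by linarith)
    calc MatrixCompletion.klDiv (Xbar.map f) (Xhat.map f)
        ≤ μ * (8 * ρ * (lam ^ 2 + 16384 * L ^ 2 * R ^ 2)) :=
          hkl.trans (mul_le_mul_of_nonneg_left (hpop.trans hmax) hμ0.le)
      _ = 8 * (μ ^ 2 / K * ((m₁ : ℝ) * m₂ * (Xbar.rank : ℝ)) *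
            (lam ^ 2 + 16384 * L ^ 2 * R ^ 2)) := by rw [hρ]; ring
      _ ≤ _ := mul_le_mul_of_nonneg_left (le_max_left _ _) (by norm_num)
  have h1 := measureReal_mono (μ := P) hcover
  have h2 := measureReal_union_le (μ := P) G (⋃ l, A l)
  rw [probReal_univ] at h1
  linarith
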